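/- Let $K\subseteq\mathbb{R}$ be a subfield with $\mathbb{Q}\subsetneq K$. Let $\mathcal{L}_\beta=\{<,+,0,1,(\lambda_k)_{k\in K}\}$ and let $T_\beta$ be the theory of ordered $K$-vector spaces with distinguished positive element $1$ (with $\lambda_k$ interpreted as $x\mapsto kx$). Let $\mathcal{L}_\alpha=\{<,+,0,1,(\lambda_q)_{q\in\mathbb{Q}}\}\subseteq\mathcal{L}_\beta$, let $T_\alpha$ be the theory of ordered $\mathbb{Q}$-vector spaces with distinguished positive element $1$, and let $\mathcal{L}^2=\mathcal{L}_\beta\cup\{A\}$ with $A$ a new unary predicate. Let $T^d_K$ be the $\mathcal{L}^2$-theory whose models are the pairs $(\mathcal{R},\mathcal{Q})$ such that (1) $\mathcal{R}$ is an ordered $K$-vector space with distinguished positive element $1$; (2) $Q$ (the interpretation of $A$) is a $\mathbb{Q}$-vector subspace of $\mathcal R$ containing $1$; (3) $Q$ is dense in $R$; and for every finite $\mathbb{Q}$-linearly independent $\{k_1,\dots,k_n\}\subseteq K$: (4) $\lambda_{k_1}(Q)+\dots+\lambda_{k_n}(Q)\neq R$, and (5) for all $x_1,\dots,x_n\in Q$,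 $\lambda_{k_1}(x_1)+\dots+\lambda_{k_n}(x_n)=0$ implies $x_1=\dots=x_n=0$. Then $T^d_K$ is an o-ML-theory with respect to $T_\alpha,T_\beta$. That is: $T_\alpha$ and $T_\beta$ are consistent o-minimal theories extending the theory of dense linear orders without endpoints; $T_\beta$ is geometric (it eliminates $\exists^\infty$, and $\operatorname{acl}$ is a pregeometry in each of its models); the theory $T^2$, consisting of $T_\beta$, the relativizations $\phi_A$ to $A$ of all $\mathcal{L}_\alpha$-sentences $\phi$ with $T_\alpha\models\phi$, and the sentences saying that $A$ is closed under the functions of $\mathcal{L}_\alpha$, is consistent; $T:=T^d_K$ extends $T^2$; and the following conditions hold, where $(\mathcal{B},\mathcal{A})$ denotes a model of $T$ with underlying sets $B\supseteq A$, and $\operatorname{acl}$ and independence are computed in $\mathcal{B}$. (Mordell–Lang) Let $p(\vec x_\alpha)$ be a complete $\mathcal{L}_\alpha$-type in a subtuple $\vec x_\alpha$ of $\vec x$, let $q(\vec x)$ be a complete $\mathcal{L}_\beta$-type, let $\phi(\vec x,y)$ be an $\mathcal{L}_\beta$-formula and $\psi(\vec x_\alpha,y)$ an $\mathcal{L}_\alpha$-formula,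 with $q(\vec x)\models\exists^{<\infty}y\,\phi(\vec x,y)$. A contender is a pair $((\mathcal{B},\mathcal{A}),\vec c)$ with $(\mathcal{B},\mathcal{A})\models T$ such that $\vec c$ in $B$ realizes $q$, the subtuple $\vec c_\alpha$ of the components of $\vec c$ lying in $A$ corresponds to $\vec x_\alpha$ and realizes $p_A=\{\theta_A:\theta\in p\}$, and every subset of $\vec c$ that is $\operatorname{acl}$-independent over $\vec c_\alpha$ is $\operatorname{acl}$-independent over $A$. A solution is a contender together with some $a\in A$ such that $\phi(\vec c,a)\wedge\psi_A(\vec c_\alpha,a)$ holds in $(\mathcal{B},\mathcal{A})$. If a solution exists, then every contender $((\mathcal{B},\mathcal{A}),\vec c)$ extends to a solution $((\mathcal{B},\mathcal{A}),\vec c,a)$. Moreover, for every cardinal $\kappa>|T^2|=\max(\aleph_0,|\mathcal{L}^2|)$, every $\kappa$-saturated model $(\mathcal{B},\mathcal{A})$ of $T$, every $C\subseteq B$ with $|C|<\kappa$, and every non-algebraic complete unary $\mathcal{L}_\beta(C)$-type $q(x)$: (Density) if $p(x)$ is a complete unary $\mathcal{L}_\alpha(A\cap C)$-type of $\mathcal{A}$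 all of whose quantifier-free formulas are implied by $q$, then some $a\in A$ realizes $p_A\cup q$; (Codensity) some $b\in B\setminus\operatorname{acl}(A\cup C)$ realizes $q$. -/

import Mathlib

open FirstOrder FirstOrder.Language Cardinal

universe w

noncomputable section

namespace PairsOfStructures

/-! ### Algebraic closure, geometric theories, o-minimal theories, saturation -/

section General

variable (L : FirstOrder.Language.{0, 0})

/-- Model-theoretic algebraic closure of `C` in `M`: the union of all finite sets definable with
parameters from `C`. -/
def acl {M : Type w} [L.Structure M] (C : Set M) : Set M :=
  {b | ∃ S : Set M, C.Definable₁ L S ∧ S.Finite ∧ b ∈ S}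

/-- `cl` is the closure operator of a pregeometry. -/
structure IsPregeometry {M : Type w} (cl : Set M → Set M) : Prop where
  subset_cl : ∀ X, X ⊆ cl X
  mono : ∀ X Y, X ⊆ Y → cl X ⊆ cl Y
  idem : ∀ X, cl (cl X) = cl X
  finitary : ∀ X, ∀ a ∈ cl X, ∃ Y ⊆ X, Y.Finite ∧ a ∈ cl Y
  exchange : ∀ X, ∀ a b, a ∈ cl (insert b X) → a ∉ cl X → b ∈ cl (insert a X)

variable {L}

/-- `T` eliminates the quantifier `∃^∞`: for every formula `φ(x, y)` there is a formula `ψ(x)`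
which holds of a tuple `c` in a model exactly when `φ(c, y)` has infinitely many solutions. -/
def EliminatesExistsInfinity (T : L.Theory) : Prop :=
  ∀ (n : ℕ) (φ : L.Formula (Fin n ⊕ Unit)), ∃ ψ : L.Formula (Fin n),
    ∀ (M : Type w) [Nonempty M] [L.Structure M], M ⊨ T → ∀ c : Fin n → M,
      ψ.Realize c ↔ {b : M | φ.Realize (Sum.elim c fun _ => b)}.Infinite

/-- A geometric theory. -/
def IsGeometric (T : L.Theory) : Prop :=
  EliminatesExistsInfinity.{w} T ∧
    ∀ (M : Type w) [Nonempty M] [L.Structure M], M ⊨ T →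
      IsPregeometry (acl L : Set M → Set M)

/-- `X` is `acl`-independent over `Z`. -/
def AclIndepOver (L : FirstOrder.Language.{0, 0}) {M : Type w} [L.Structure M] (X Z : Set M) : Prop :=
  ∀ a ∈ X, a ∉ acl L ((X \ {a}) ∪ Z)

/-- `X` and `Y` are independent over `Z`: every subset of `X` that is `acl`-independent over `Z`
is `acl`-independent over `Y ∪ Z`. -/
def Indep (L : FirstOrder.Language.{0, 0}) {M : Type w} [L.Structure M] (X Y Z : Set M) : Prop :=
  ∀ S ⊆ X, AclIndepOver L S Z → AclIndepOver L S (Y ∪ Z)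

/-- The binary relation on `M` named by a binary relation symbol. -/
def relOf {M : Type w} [L.Structure M] (lt : L.Relations 2) (a b : M) : Prop :=
  Structure.RelMap lt ![a, b]

/-- `r` is (the strict order of) a dense linear order without endpoints. -/
structure IsDLO {M : Type w} (r : M → M → Prop) : Prop where
  irrefl : ∀ a, ¬ r a a
  trans : ∀ a b c, r a b → r b c → r a c
  total : ∀ a b, r a b ∨ a = b ∨ r b a
  dense : ∀ a b, r a b → ∃ c, r a c ∧ r c b
  exists_lt : ∀ a, ∃ b, r b a
  exists_gt : ∀ a, ∃ b, r a b

/-- `T` extends the theory of dense linear orders without endpoints, with `lt` as order symbol. -/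
def ExtendsDLO (T : L.Theory) (lt : L.Relations 2) : Prop :=
  ∀ (M : Type w) [Nonempty M] [L.Structure M], M ⊨ T → IsDLO (relOf lt : M → M → Prop)

/-- `S` is a point, or an open interval with endpoints in `M ∪ {-∞, +∞}`. -/
def IsPointOrInterval {M : Type w} (r : M → M → Prop) (S : Set M) : Prop :=
  (∃ a, S = {a}) ∨ (∃ a b, S = {x | r a x ∧ r x b}) ∨ (∃ a, S = {x | r a x}) ∨
    (∃ b, S = {x | r x b}) ∨ S = Set.univ

/-- `T` is o-minimal: in every model, every subset of the line that is definable with parameters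
is a finite union of points and open intervals. -/
def IsOMinimal (T : L.Theory) (lt : L.Relations 2) : Prop :=
  ∀ (M : Type w) [Nonempty M] [L.Structure M], M ⊨ T →
    ∀ S : Set M, (Set.univ : Set M).Definable₁ L S →
      ∃ F : Set (Set M), F.Finite ∧ (∀ I ∈ F, IsPointOrInterval (relOf lt) I) ∧ S = ⋃₀ F

/-- Formulas in one variable `x` with parameters from `C`: formulas whose free variables are the
elements of `C` (each interpreted by itself) and one further variable. -/
abbrev FormulaOver (L : FirstOrder.Language.{0, 0}) {M : Type w} (C : Set M) := L.Formula (C ⊕ Unit)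

/-- `b` satisfies the formula `φ(x)` with parameters from `C`. -/
def SatOver {M : Type w} [L.Structure M] {C : Set M} (φ : FormulaOver L C) (b : M) : Prop :=
  φ.Realize (Sum.elim (fun c : C => (c : M)) fun _ => b)

/-- A set of formulas over `C` is finitely satisfiable in `M`. -/
def FinSat {M : Type w} [L.Structure M] {C : Set M} (Γ : Set (FormulaOver L C)) : Prop :=
  ∀ Δ : Finset (FormulaOver L C), ↑Δ ⊆ Γ → ∃ b : M, ∀ φ ∈ Δ, SatOver φ b

/-- `q` is a complete unary type over `C ⊆ M` (finitely satisfiable in `M`, that is, realized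
in an elementary extension of `M`). -/
structure IsTypeOver {M : Type w} [L.Structure M] {C : Set M}
    (q : Set (FormulaOver L C)) : Prop where
  finSat : FinSat q
  complete : ∀ φ : FormulaOver L C, φ ∈ q ∨ φ.not ∈ q

/-- A type over `C` is non-algebraic if none of its formulas has only finitely many solutions. -/
def NonAlgebraic {M : Type w} [L.Structure M] {C : Set M} (q : Set (FormulaOver L C)) : Prop :=
  ∀ φ ∈ q, {b : M | SatOver φ b}.Infinite

/-- `M` is `κ`-saturated: every finitely satisfiable set of formulas in one variable over a set
of fewer than `κ` parameters is realized. -/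
def IsSaturated (L : FirstOrder.Language.{0, 0}) (M : Type w) [L.Structure M] (κ : Cardinal.{w}) : Prop :=
  ∀ C : Set M, #C < κ → ∀ Γ : Set (FormulaOver L C), FinSat Γ → ∃ b : M, ∀ φ ∈ Γ, SatOver φ b

/-- The tuple `v` in `M` realizes the complete type `p`. -/
def RealizesType {T : L.Theory} {α : Type} (p : T.CompleteType α) {M : Type w} [L.Structure M]
    (v : α → M) : Prop :=
  ∀ θ : L.Formula α, Formula.equivSentence θ ∈ p → θ.Realize v

end General

/-! ### Pairs `(𝓑, 𝓐)`

Throughout, `Lα` is a sublanguage of `Lβ`, via an injective map `ι : Lα →ᴸ Lβ`; so the common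
language is `Lα` itself, and there are no relation symbols of `Lα` outside `Lβ`. -/

section Pairs

/-- The only symbol of this family is a unary predicate. -/
inductive PredSymbol : ℕ → Type
  | A : PredSymbol 1

/-- The language with a single unary predicate symbol `A`. -/
def predLang : FirstOrder.Language.{0, 0} := ⟨fun _ => Empty, PredSymbol⟩

/-- The language `L²`, that is, `Lβ` together with a new unary predicate symbol `A`. -/
abbrev pairLang (Lβ : FirstOrder.Language.{0, 0}) : FirstOrder.Language.{0, 0} := Lβ.sum predLang

/-- The symbol `A` in `L²`. -/
def predA (Lβ : FirstOrder.Language.{0, 0}) : (pairLang Lβ).Relations 1 := Sum.inr PredSymbol.A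

variable {Lα Lβ : FirstOrder.Language.{0, 0}} (ι : Lα →ᴸ Lβ)

/-- The inclusion of `Lα` in `L²`. -/
def toPair : Lα →ᴸ pairLang Lβ := LHom.sumInl.comp ι

/-- The relativization `θ_A` of an `Lα`-formula `θ`: all quantifiers are restricted to `A`. -/
def relativize {α : Type w} : ∀ {n : ℕ}, Lα.BoundedFormula α n → (pairLang Lβ).BoundedFormula α n
  | _, .falsum => .falsum
  | _, .equal t₁ t₂ => .equal ((toPair ι).onTerm t₁) ((toPair ι).onTerm t₂)
  | _, .rel R ts => .rel ((toPair ι).onRelation R) fun i => (toPair ι).onTerm (ts i)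
  | _, .imp θ₁ θ₂ => (relativize θ₁).imp (relativize θ₂)
  | n, .all θ =>
      (((predA Lβ).boundedFormula₁ (Term.var (Sum.inr (Fin.last n)))).imp (relativize θ)).all

/-- The sentence saying that `A` is closed under the function symbol `f` of `Lα`. -/
def closureSentence {n : ℕ} (f : Lα.Functions n) : (pairLang Lβ).Sentence :=
  Formula.iAlls (Fin n) <|
    (Formula.iInf fun i : Fin n => (predA Lβ).formula₁ (Term.var (Sum.inr i))).imp
      ((predA Lβ).formula₁
        (Term.func ((toPair ι).onFunction f) fun i => Term.var (Sum.inr i)))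

/-- The theory `T²`: `Tβ`, the relativizations of all consequences of `Tα`, and the closure of
`A` under the functions of `Lα`. (The schema about relation symbols of `Lα` not in `Lβ` is
empty, as `Lα` is a sublanguage of `Lβ`.) -/
def T2 (Tα : Lα.Theory) (Tβ : Lβ.Theory) : (pairLang Lβ).Theory :=
  LHom.sumInl.onTheory Tβ ∪ {θ | ∃ φ : Lα.Sentence, Tα ⊨ᵇ φ ∧ θ = relativize ι φ} ∪
    {θ | ∃ (n : ℕ) (f : Lα.Functions n), θ = closureSentence ι f}

/-- The interpretation of the predicate symbol by a set. -/
@[reducible]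
def predStructure {M : Type w} (A : Set M) : predLang.Structure M where
  funMap f := f.elim
  RelMap
    | PredSymbol.A, x => x 0 ∈ A

/-- The `L²`-structure with `Lβ`-reduct `M` in which the predicate symbol names `A`. -/
@[reducible]
def pairStructure (Lβ : FirstOrder.Language.{0, 0}) {M : Type w} [Lβ.Structure M] (A : Set M) :
    (pairLang Lβ).Structure M :=
  letI := predStructure A
  FirstOrder.Language.sumStructure Lβ predLang M

/-- `(M, A)` is a model of the `L²`-theory `T`. Every `L²`-structure arises in this way from
exactly one pair `(M, A)`. -/
def PairModels (T : (pairLang Lβ).Theory) (M : Type w) [Lβ.Structure M] (A : Set M) : Prop :=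
  letI := pairStructure Lβ A
  M ⊨ T

/-- The `L²`-formula `θ` holds of `v` in `(M, A)`. -/
def PairRealize {M : Type w} [Lβ.Structure M] (A : Set M) {α : Type*}
    (θ : (pairLang Lβ).Formula α) (v : α → M) : Prop :=
  letI := pairStructure Lβ A
  θ.Realize v

/-- The pair `(M, A)` is `κ`-saturated as an `L²`-structure. -/
def PairSaturated (Lβ : FirstOrder.Language.{0, 0}) (M : Type w) [Lβ.Structure M] (A : Set M)
    (κ : Cardinal.{w}) : Prop :=
  letI := pairStructure Lβ A
  IsSaturated (pairLang Lβ) M κ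

variable (Tα : Lα.Theory) (Tβ : Lβ.Theory) (T : (pairLang Lβ).Theory)

/-- A Mordell-Lang challenge `(p(x_α), q(x), φ(x, y), ψ(x_α, y))`, where `x = (x_i)_{i < n}` and
`x_α` is the subtuple of the `x_i` with `i ∈ s`. -/
structure Challenge where
  n : ℕ
  s : Set (Fin n)
  p : Tα.CompleteType s
  q : Tβ.CompleteType (Fin n)
  φ : Lβ.Formula (Fin n ⊕ Unit)
  ψ : Lα.Formula (s ⊕ Unit)
  finite : ∀ (M : Type w) [Nonempty M] [Lβ.Structure M], M ⊨ Tβ → ∀ c : Fin n → M,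
    RealizesType q c → {b : M | φ.Realize (Sum.elim c fun _ => b)}.Finite

variable {Tα Tβ}

/-- `((M, A), c)` is a contender: `(M, A)` is a model of `T`, `c` realizes `q`, the subtuple
`c_α` of the components of `c` in `A` is indexed by `s` and realizes `p_A`, and `c` is
independent from `A` over `c_α`. -/
structure IsContender (χ : Challenge.{w} Tα Tβ) (M : Type w) [Lβ.Structure M] (A : Set M)
    (c : Fin χ.n → M) : Prop where
  models : PairModels T M A
  realizes_q : RealizesType χ.q c
  mem_iff : ∀ i, c i ∈ A ↔ i ∈ χ.s
  realizes_p : ∀ θ : Lα.Formula χ.s, Formula.equivSentence θ ∈ χ.p →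
    PairRealize A (relativize ι θ) fun i : χ.s => c i
  indep : Indep Lβ (Set.range c) A (c '' χ.s)

/-- `((M, A), c, a)` is a solution. -/
structure IsSolution (χ : Challenge.{w} Tα Tβ) (M : Type w) [Lβ.Structure M] (A : Set M)
    (c : Fin χ.n → M) (a : M) : Prop where
  contender : IsContender ι T χ M A c
  mem : a ∈ A
  realizes_φ : χ.φ.Realize (Sum.elim c fun _ => a)
  realizes_ψ : PairRealize A (relativize ι χ.ψ) (Sum.elim (fun i : χ.s => c i) fun _ => a)

variable (Tα Tβ)

/-- The Mordell-Lang condition: if a challenge has a solution, then every contender extends to a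
solution. -/
def MordellLangCondition : Prop :=
  ∀ χ : Challenge.{w} Tα Tβ,
    (∃ (N : Type w) (_ : Nonempty N) (_ : Lβ.Structure N) (A : Set N) (c : Fin χ.n → N) (a : N),
      IsSolution ι T χ N A c a) →
    ∀ (M : Type w) [Nonempty M] [Lβ.Structure M] (A : Set M) (c : Fin χ.n → M),
      IsContender ι T χ M A c → ∃ a : M, IsSolution ι T χ M A c a

/-- The cardinal `|T²|`. -/
def pairCard (Lβ : FirstOrder.Language.{0, 0}) : Cardinal.{0} := max ℵ₀ (pairLang Lβ).card

/-- The `Lβ`-formula over `C` obtained from an `Lα`-formula over `A ∩ C`. -/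
def transfer {M : Type w} [Lα.Structure M] {𝒜 : Lα.Substructure M} {C : Set M}
    (θ : FormulaOver Lα {a : 𝒜 | (a : M) ∈ C}) : FormulaOver Lβ C :=
  (ι.onFormula θ).relabel
    (Sum.map (fun a : {a : 𝒜 | (a : M) ∈ C} => (⟨((a : 𝒜) : M), a.2⟩ : C)) id)

/-- The density condition. Here `𝒜` is the `Lα`-substructure with underlying set `A`, `q` is a
non-algebraic unary `Lβ`-type over `C` and `p` a unary `Lα`-type of `𝒜` over `A ∩ C`, all of
whose quantifier-free formulas belong to `q`. -/
def DensityCondition : Prop :=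
  ∀ (M : Type w) [Nonempty M] [Lβ.Structure M] [Lα.Structure M] [ι.IsExpansionOn M]
    (𝒜 : Lα.Substructure M) (κ : Cardinal.{w}),
    PairModels T M 𝒜 → Cardinal.lift.{w} (pairCard Lβ) < κ → PairSaturated Lβ M 𝒜 κ →
    ∀ C : Set M, #C < κ →
    ∀ q : Set (FormulaOver Lβ C), IsTypeOver q → NonAlgebraic q →
    ∀ p : Set (FormulaOver Lα {a : 𝒜 | (a : M) ∈ C}), IsTypeOver p →
      (∀ θ ∈ p, BoundedFormula.IsQF θ → transfer ι θ ∈ q) →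
      ∃ a ∈ 𝒜, (∀ φ ∈ q, SatOver φ a) ∧
        ∀ θ ∈ p, PairRealize (𝒜 : Set M) (relativize ι θ)
          (Sum.elim (fun c => ((c : 𝒜) : M)) fun _ => a)

/-- The codensity condition. -/
def CodensityCondition : Prop :=
  ∀ (M : Type w) [Nonempty M] [Lβ.Structure M] (A : Set M) (κ : Cardinal.{w}),
    PairModels T M A → Cardinal.lift.{w} (pairCard Lβ) < κ → PairSaturated Lβ M A κ →
    ∀ C : Set M, #C < κ →
    ∀ q : Set (FormulaOver Lβ C), IsTypeOver q → NonAlgebraic q →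
      ∃ b : M, b ∉ acl Lβ (A ∪ C) ∧ ∀ φ ∈ q, SatOver φ b

/-- `T` is an ML-theory (a Mordell-Lang theory of pairs) with respect to `Tα` and `Tβ`. -/
structure IsMLTheory : Prop where
  extends_T2 : ∀ θ ∈ T2 ι Tα Tβ, T ⊨ᵇ θ
  mordellLang : MordellLangCondition.{w} ι Tα Tβ T
  density : DensityCondition.{w} ι T
  codensity : CodensityCondition.{w} T

/-- `T` is an o-ML-theory with respect to `Tα` and `Tβ`, with `lt` as order symbol: the standing
assumptions on `Lα ⊆ Lβ`, `Tα`, `Tβ` and `T²` hold, `Tα` and `Tβ` are o-minimal theories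
extending the theory of dense linear orders without endpoints, and `T` is an ML-theory. -/
structure IsOMLTheory (lt : Lα.Relations 2) : Prop where
  sublanguage : ι.Injective
  satisfiable_α : Tα.IsSatisfiable
  satisfiable_β : Tβ.IsSatisfiable
  satisfiable_T2 : (T2 ι Tα Tβ).IsSatisfiable
  geometric : IsGeometric.{w} Tβ
  extendsDLO_α : ExtendsDLO.{w} Tα lt
  extendsDLO_β : ExtendsDLO.{w} Tβ (ι.onRelation lt)
  oMinimal_α : IsOMinimal.{w} Tα lt
  oMinimal_β : IsOMinimal.{w} Tβ (ι.onRelation lt)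
  isMLTheory : IsMLTheory.{w} ι Tα Tβ T

end Pairs

/-! ### Ordered vector spaces -/

section OrderedVectorSpaces

/-- Function symbols `0`, `1`, `+` and `λ_k` for `k ∈ F`. -/
inductive OVSFunc (F : Type) : ℕ → Type
  | zero : OVSFunc F 0
  | one : OVSFunc F 0
  | add : OVSFunc F 2
  | smul (k : F) : OVSFunc F 1

/-- The relation symbol `<`. -/
inductive OVSRel : ℕ → Type
  | lt : OVSRel 2

/-- The language `{<, +, 0, 1, (λ_k)_{k ∈ F}}` of ordered `F`-vector spaces with a distinguished
positive element. -/
def ovsLang (F : Type) : FirstOrder.Language.{0, 0} := ⟨OVSFunc F, OVSRel⟩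

/-- The map of languages sending `λ_k` to `λ_{f k}`. -/
def ovsMap {F G : Type} (f : F → G) : ovsLang F →ᴸ ovsLang G where
  onFunction
    | _, .zero => OVSFunc.zero
    | _, .one => OVSFunc.one
    | _, .add => OVSFunc.add
    | _, .smul k => OVSFunc.smul (f k)
  onRelation := fun _ R => R

variable {F : Type}

/-- The order symbol. -/
def ltSymb : (ovsLang F).Relations 2 := OVSRel.lt

/-- The symbol `0`. -/
def zeroSymb : (ovsLang F).Constants := OVSFunc.zero

/-- The symbol `1`. -/
def oneSymb : (ovsLang F).Constants := OVSFunc.one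

/-- The symbol `+`. -/
def addSymb : (ovsLang F).Functions 2 := OVSFunc.add

/-- The symbol `λ_k`. -/
def smulSymb (k : F) : (ovsLang F).Functions 1 := OVSFunc.smul k

/-- The term `0`. -/
def tZero {α : Type} : (ovsLang F).Term α := Constants.term zeroSymb

/-- The term `1`. -/
def tOne {α : Type} : (ovsLang F).Term α := Constants.term oneSymb

/-- The term `s + t`. -/
def tAdd {α : Type} (s t : (ovsLang F).Term α) : (ovsLang F).Term α :=
  addSymb.apply₂ s t

/-- The term `λ_k(t)`. -/
def tSmul {α : Type} (k : F) (t : (ovsLang F).Term α) : (ovsLang F).Term α :=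
  (smulSymb k).apply₁ t

/-- The term `λ_{k_1}(x_1) + ⋯ + λ_{k_n}(x_n)`. -/
def tLinComb {α : Type} {n : ℕ} (k : Fin n → F) (x : Fin n → α) : (ovsLang F).Term α :=
  (List.ofFn fun i => tSmul (k i) (Term.var (x i))).foldr tAdd tZero

/-- The formula `s < t`. -/
def fLt {α : Type} {n : ℕ} (s t : (ovsLang F).Term (α ⊕ Fin n)) :
    (ovsLang F).BoundedFormula α n :=
  ltSymb.boundedFormula₂ s t

/-- Names of the axioms of ordered `F`-vector spaces with a distinguished positive element. -/
inductive OVSAxiom (F : Type) [Zero F] [LT F] : Type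
  | addAssoc | addComm | addZero | addNeg
  | smulAdd (k : F) | addSmul (k l : F) | mulSmul (k l : F) | oneSmul
  | ltIrrefl | ltTrans | ltTotal | addLt
  | smulPos (k : F) (hk : 0 < k)
  | onePos

/-- The axioms of ordered `F`-vector spaces with a distinguished positive element. -/
def OVSAxiom.toSentence [Field F] [LinearOrder F] : OVSAxiom F → (ovsLang F).Sentence
  | .addAssoc => ∀' ∀' ∀' (tAdd (tAdd (&0) (&1)) (&2) =' tAdd (&0) (tAdd (&1) (&2)))
  | .addComm => ∀' ∀' (tAdd (&0) (&1) =' tAdd (&1) (&0))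
  | .addZero => ∀' (tAdd (&0) tZero =' &0)
  | .addNeg => ∀' (tAdd (&0) (tSmul (-1) (&0)) =' tZero)
  | .smulAdd k => ∀' ∀' (tSmul k (tAdd (&0) (&1)) =' tAdd (tSmul k (&0)) (tSmul k (&1)))
  | .addSmul k l => ∀' (tSmul (k + l) (&0) =' tAdd (tSmul k (&0)) (tSmul l (&0)))
  | .mulSmul k l => ∀' (tSmul (k * l) (&0) =' tSmul k (tSmul l (&0)))
  | .oneSmul => ∀' (tSmul 1 (&0) =' &0)
  | .ltIrrefl => ∀' ∼(fLt (&0) (&0))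
  | .ltTrans => ∀' ∀' ∀' (fLt (&0) (&1) ⟹ fLt (&1) (&2) ⟹ fLt (&0) (&2))
  | .ltTotal => ∀' ∀' (fLt (&0) (&1) ⊔ ((&0 =' &1) ⊔ fLt (&1) (&0)))
  | .addLt => ∀' ∀' ∀' (fLt (&0) (&1) ⟹ fLt (tAdd (&0) (&2)) (tAdd (&1) (&2)))
  | .smulPos k _ => ∀' (fLt tZero (&0) ⟹ fLt tZero (tSmul k (&0)))
  | .onePos => fLt tZero tOne

/-- The theory of ordered `F`-vector spaces with a distinguished positive element. -/
def ovsTheory (F : Type) [Field F] [LinearOrder F] : (ovsLang F).Theory :=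
  Set.range (OVSAxiom.toSentence (F := F))

variable (K : Subfield ℝ)

/-- The inclusion of the language of ordered `ℚ`-vector spaces in that of ordered `K`-vector
spaces. -/
def ovsIncl : ovsLang ℚ →ᴸ ovsLang K := ovsMap fun q : ℚ => (q : K)

/-- The formula `A(x_1) ∧ ⋯ ∧ A(x_n)`. -/
def fAllA {α : Type} {n : ℕ} (x : Fin n → α) : (pairLang (ovsLang K)).Formula α :=
  Formula.iInf fun i => (predA (ovsLang K)).formula₁ (Term.var (x i))

/-- `A` is dense: `∀ x y, x < y → ∃ z, A(z) ∧ x < z ∧ z < y`. -/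
def densitySentence : (pairLang (ovsLang K)).Sentence :=
  ∀' ∀' (LHom.sumInl.onBoundedFormula (fLt (F := K) (&0) (&1)) ⟹
    ∃' ((predA (ovsLang K)).boundedFormula₁ (&2) ⊓
      (LHom.sumInl.onBoundedFormula (fLt (F := K) (&0) (&2)) ⊓
        LHom.sumInl.onBoundedFormula (fLt (F := K) (&2) (&1)))))

/-- `∃ r ∀ x_1 … x_n, A(x_1) ∧ ⋯ ∧ A(x_n) → r ≠ λ_{k_1}(x_1) + ⋯ + λ_{k_n}(x_n)`. -/
def notCoveredSentence {n : ℕ} (k : Fin n → K) : (pairLang (ovsLang K)).Sentence :=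
  Formula.iExs Unit <| Formula.iAlls (Fin n) <|
    (fAllA K Sum.inr).imp
      (Term.equal (Term.var (Sum.inl (Sum.inr ())))
        (LHom.sumInl.onTerm (tLinComb k Sum.inr))).not

/-- `∀ x_1 … x_n, A(x_1) ∧ ⋯ ∧ A(x_n) ∧ λ_{k_1}(x_1) + ⋯ + λ_{k_n}(x_n) = 0 →
x_1 = 0 ∧ ⋯ ∧ x_n = 0`. -/
def independentSentence {n : ℕ} (k : Fin n → K) : (pairLang (ovsLang K)).Sentence :=
  Formula.iAlls (Fin n) <|
    (fAllA K Sum.inr).imp <|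
      (Term.equal (LHom.sumInl.onTerm (tLinComb k Sum.inr)) (LHom.sumInl.onTerm tZero)).imp <|
        Formula.iInf fun i : Fin n =>
          Term.equal (Term.var (Sum.inr i)) (LHom.sumInl.onTerm tZero)

/-- The theory `T^d_K` of pairs `(R, Q)`: `R` is an ordered `K`-vector space with distinguished
positive element `1`; `Q` contains `0` and `1` and is closed under `+` and `λ_q` for `q ∈ ℚ`; `Q`
is dense in `R`; and for all `ℚ`-linearly independent `k_1, …, k_n ∈ K` we have
`λ_{k_1}(Q) + ⋯ + λ_{k_n}(Q) ≠ R`, and `λ_{k_1}(x_1) + ⋯ + λ_{k_n}(x_n) = 0` with `x_i ∈ Q`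
only if all `x_i` are `0`. -/
def TdK : (pairLang (ovsLang K)).Theory :=
  LHom.sumInl.onTheory (ovsTheory K) ∪
    {θ | ∃ (n : ℕ) (f : (ovsLang ℚ).Functions n), θ = closureSentence (ovsIncl K) f} ∪
    {densitySentence K} ∪
    {θ | ∃ (n : ℕ) (k : Fin n → K), LinearIndependent ℚ k ∧ θ = notCoveredSentence K k} ∪
    {θ | ∃ (n : ℕ) (k : Fin n → K), LinearIndependent ℚ k ∧ θ = independentSentence K k}

end OrderedVectorSpaces

end PairsOfStructures

end

noncomputable section

namespace PairsOfStructures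

/-! ### Models of the theory of ordered vector spaces -/

section Models

variable (F : Type) (M : Type w) [(ovsLang F).Structure M]

/-- The interpretation of `0`. -/
def ovsZero : M := ((zeroSymb : (ovsLang F).Constants) : M)

/-- The interpretation of `1`. -/
def ovsOne : M := ((oneSymb : (ovsLang F).Constants) : M)

variable {M}

/-- The interpretation of `+`. -/
def ovsAdd (a b : M) : M := Structure.funMap (addSymb (F := F)) ![a, b]

variable {F}

/-- The interpretation of `λ_k`. -/
def ovsSmul (k : F) (a : M) : M := Structure.funMap (smulSymb k) ![a]

variable (F) in
/-- The interpretation of `<`. -/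
def ovsLt (a b : M) : Prop := relOf (ltSymb (F := F)) a b

variable (F) (M) in
/-- The axioms of ordered vector spaces, stated for the interpretations of the symbols. -/
structure OVSLaws [Field F] [LinearOrder F] : Prop where
  add_assoc : ∀ a b c : M, ovsAdd F (ovsAdd F a b) c = ovsAdd F a (ovsAdd F b c)
  add_comm : ∀ a b : M, ovsAdd F a b = ovsAdd F b a
  add_zero : ∀ a : M, ovsAdd F a (ovsZero F M) = a
  add_neg : ∀ a : M, ovsAdd F a (ovsSmul (-1 : F) a) = ovsZero F M
  smul_add : ∀ (k : F) (a b : M), ovsSmul k (ovsAdd F a b) = ovsAdd F (ovsSmul k a) (ovsSmul k b)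
  add_smul : ∀ (k l : F) (a : M), ovsSmul (k + l) a = ovsAdd F (ovsSmul k a) (ovsSmul l a)
  mul_smul : ∀ (k l : F) (a : M), ovsSmul (k * l) a = ovsSmul k (ovsSmul l a)
  one_smul : ∀ a : M, ovsSmul (1 : F) a = a
  lt_irrefl : ∀ a : M, ¬ ovsLt F a a
  lt_trans : ∀ a b c : M, ovsLt F a b → ovsLt F b c → ovsLt F a c
  lt_total : ∀ a b : M, ovsLt F a b ∨ a = b ∨ ovsLt F b a
  add_lt : ∀ a b c : M, ovsLt F a b → ovsLt F (ovsAdd F a c) (ovsAdd F b c)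
  smul_pos : ∀ k : F, 0 < k → ∀ a : M, ovsLt F (ovsZero F M) a → ovsLt F (ovsZero F M) (ovsSmul k a)
  one_pos : ovsLt F (ovsZero F M) (ovsOne F M)

theorem realize_fLt {α : Type} {n : ℕ} (v : α → M) (xs : Fin n → M)
    (s t : (ovsLang F).Term (α ⊕ Fin n)) :
    (fLt s t).Realize v xs ↔
      ovsLt F (s.realize (Sum.elim v xs)) (t.realize (Sum.elim v xs)) := by
  simp [fLt, BoundedFormula.realize_rel₂, ovsLt, relOf]

theorem models_ovsTheory_iff [Field F] [LinearOrder F] :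
    M ⊨ ovsTheory F ↔ OVSLaws F M := by
  have key : ∀ a : OVSAxiom F, M ⊨ a.toSentence ↔ match a with
      | .addAssoc => ∀ a b c : M, ovsAdd F (ovsAdd F a b) c = ovsAdd F a (ovsAdd F b c)
      | .addComm => ∀ a b : M, ovsAdd F a b = ovsAdd F b a
      | .addZero => ∀ a : M, ovsAdd F a (ovsZero F M) = a
      | .addNeg => ∀ a : M, ovsAdd F a (ovsSmul (-1 : F) a) = ovsZero F M
      | .smulAdd k => ∀ a b : M,
          ovsSmul k (ovsAdd F a b) = ovsAdd F (ovsSmul k a) (ovsSmul k b)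
      | .addSmul k l => ∀ a : M, ovsSmul (k + l) a = ovsAdd F (ovsSmul k a) (ovsSmul l a)
      | .mulSmul k l => ∀ a : M, ovsSmul (k * l) a = ovsSmul k (ovsSmul l a)
      | .oneSmul => ∀ a : M, ovsSmul (1 : F) a = a
      | .ltIrrefl => ∀ a : M, ¬ ovsLt F a a
      | .ltTrans => ∀ a b c : M, ovsLt F a b → ovsLt F b c → ovsLt F a c
      | .ltTotal => ∀ a b : M, ovsLt F a b ∨ a = b ∨ ovsLt F b a
      | .addLt => ∀ a b c : M, ovsLt F a b → ovsLt F (ovsAdd F a c) (ovsAdd F b c)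
      | .smulPos k _ => ∀ a : M, ovsLt F (ovsZero F M) a → ovsLt F (ovsZero F M) (ovsSmul k a)
      | .onePos => ovsLt F (ovsZero F M) (ovsOne F M) := by
    intro a
    cases a <;>
    simp [OVSAxiom.toSentence, tAdd, tSmul, tZero, tOne, Sentence.Realize, Formula.Realize,
      realize_fLt, Fin.snoc, ovsAdd, ovsSmul, ovsZero, ovsOne]
  rw [Theory.model_iff]
  constructor
  · intro h
    have h' : ∀ a : OVSAxiom F, M ⊨ a.toSentence := fun a => h _ ⟨a, rfl⟩
    exact ⟨(key .addAssoc).1 (h' _), (key .addComm).1 (h' _), (key .addZero).1 (h' _),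
      (key .addNeg).1 (h' _), fun k => (key (.smulAdd k)).1 (h' _),
      fun k l => (key (.addSmul k l)).1 (h' _), fun k l => (key (.mulSmul k l)).1 (h' _),
      (key .oneSmul).1 (h' _), (key .ltIrrefl).1 (h' _), (key .ltTrans).1 (h' _),
      (key .ltTotal).1 (h' _), (key .addLt).1 (h' _),
      fun k hk => (key (.smulPos k hk)).1 (h' _), (key .onePos).1 (h' _)⟩
  · rintro h _ ⟨a, rfl⟩
    rw [key]
    cases a with
    | addAssoc => exact h.add_assoc
    | addComm => exact h.add_comm
    | addZero => exact h.add_zero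
    | addNeg => exact h.add_neg
    | smulAdd k => exact h.smul_add k
    | addSmul k l => exact h.add_smul k l
    | mulSmul k l => exact h.mul_smul k l
    | oneSmul => exact h.one_smul
    | ltIrrefl => exact h.lt_irrefl
    | ltTrans => exact h.lt_trans
    | ltTotal => exact h.lt_total
    | addLt => exact h.add_lt
    | smulPos k hk => exact h.smul_pos k hk
    | onePos => exact h.one_pos

/-- The algebraic operations and the order of `M` are the interpretations of the symbols, and they
make `M` an ordered vector space with distinguished positive element. -/
class IsOVS (F : Type) (M : Type w) [(ovsLang F).Structure M] [Field F] [LinearOrder F]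
    [AddCommGroup M] [Module F M] [LinearOrder M] : Prop extends IsOrderedAddMonoid M where
  ovsZero_eq : ovsZero F M = 0
  ovsAdd_eq (a b : M) : ovsAdd F a b = a + b
  ovsSmul_eq (k : F) (a : M) : ovsSmul k a = k • a
  ovsLt_iff (a b : M) : ovsLt F a b ↔ a < b
  smul_pos (k : F) (a : M) : 0 < k → 0 < a → 0 < k • a
  one_pos : 0 < ovsOne F M

/-- Passes from the axioms to instances whose operations are the interpretations of the symbols, so
that ordinary ordered linear algebra applies to any model. -/
theorem exists_isOVS [Field F] [LinearOrder F] (h : M ⊨ ovsTheory F) :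
    ∃ (_ : AddCommGroup M) (_ : Module F M) (_ : LinearOrder M), IsOVS F M := by
  classical
  have h := models_ovsTheory_iff.1 h
  let _ : Add M := ⟨ovsAdd F⟩
  let _ : Zero M := ⟨ovsZero F M⟩
  let _ : Neg M := ⟨ovsSmul (-1 : F)⟩
  let _ : AddCommGroup M :=
    { add_assoc := h.add_assoc
      add_comm := h.add_comm
      add_zero := h.add_zero
      zero_add := fun a => (h.add_comm _ _).trans (h.add_zero a)
      neg_add_cancel := fun a => (h.add_comm _ _).trans (h.add_neg a)
      nsmul := nsmulRec
      zsmul := zsmulRec }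
  let _ : SMul F M := ⟨ovsSmul⟩
  have hadd : ∀ (k l : F) (a : M), (k + l) • a = k • a + l • a := h.add_smul
  have hsmul : ∀ (k : F) (a b : M), k • (a + b) = k • a + k • b := h.smul_add
  let _ : Module F M :=
    { smul_add := h.smul_add
      add_smul := h.add_smul
      mul_smul := h.mul_smul
      one_smul := h.one_smul
      zero_smul := fun a => by simpa using hadd 0 0 a
      smul_zero := fun k => by simpa using hsmul k 0 0 }
  let _ : LinearOrder M :=
    { lt := ovsLt F
      le := fun a b => ovsLt F a b ∨ a = b
      le_refl := fun a => .inr rfl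
      le_trans := by
        rintro a b c (hab | rfl) (hbc | rfl)
        exacts [.inl (h.lt_trans _ _ _ hab hbc), .inl hab, .inl hbc, .inr rfl]
      le_antisymm := by
        rintro a b (hab | rfl) (hba | hba)
        exacts [(h.lt_irrefl _ (h.lt_trans _ _ _ hab hba)).elim, hba.symm, rfl, rfl]
      lt_iff_le_not_ge := fun a b => by
        constructor
        · refine fun hab => ⟨.inl hab, ?_⟩
          rintro (hba | rfl)
          exacts [h.lt_irrefl _ (h.lt_trans _ _ _ hab hba), h.lt_irrefl _ hab]
        · rintro ⟨hab | rfl, hba⟩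
          exacts [hab, (hba (.inr rfl)).elim]
      le_total := fun a b => by
        rcases h.lt_total a b with hab | rfl | hba
        exacts [.inl (.inl hab), .inl (.inr rfl), .inr (.inl hba)]
      toDecidableLE := Classical.decRel _ }
  have hord : IsOrderedAddMonoid M := ⟨by
    rintro a b (hab | rfl) c
    exacts [.inl (h.add_lt _ _ _ hab), .inr rfl], by
    rintro a b (hab | rfl) c
    · left
      rw [add_comm c a, add_comm c b]
      exact h.add_lt _ _ _ hab
    · exact .inr rfl⟩
  exact ⟨inferInstance, inferInstance, inferInstance,
    { ovsZero_eq := rfl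
      ovsAdd_eq := fun _ _ => rfl
      ovsSmul_eq := fun _ _ => rfl
      ovsLt_iff := fun _ _ => Iff.rfl
      smul_pos := fun k a hk => h.smul_pos k hk a
      one_pos := h.one_pos }⟩

theorem IsOVS.models [Field F] [LinearOrder F] [AddCommGroup M] [Module F M] [LinearOrder M]
    [IsOVS F M] : M ⊨ ovsTheory F := by
  rw [models_ovsTheory_iff]
  constructor <;> simp only [IsOVS.ovsZero_eq, IsOVS.ovsAdd_eq, IsOVS.ovsSmul_eq, IsOVS.ovsLt_iff]
  · exact add_assoc
  · exact add_comm
  · exact add_zero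
  · intro a; simp
  · exact fun k a b => _root_.smul_add k a b
  · exact fun k l a => _root_.add_smul k l a
  · exact fun k l a => SemigroupAction.mul_smul k l a
  · exact fun a => _root_.one_smul F a
  · exact fun a => _root_.lt_irrefl a
  · exact fun a b c => _root_.lt_trans
  · exact fun a b => _root_.lt_trichotomy a b
  · exact fun a b c hab => by simpa using hab
  · exact fun k hk a => IsOVS.smul_pos k a hk
  · exact IsOVS.one_pos

/-- Universal theories pass to substructures; this makes the predicate `A` of a pair a model of the
rational theory. -/
instance [Field F] [LinearOrder F] : (ovsTheory F).IsUniversal := by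
  have hlt : ∀ {n : ℕ} (s t : (ovsLang F).Term (Empty ⊕ Fin n)), (fLt s t).IsQF :=
    fun s t => (BoundedFormula.IsAtomic.rel _ _).isQF
  have heq : ∀ {n : ℕ} (s t : (ovsLang F).Term (Empty ⊕ Fin n)), (s =' t).IsQF :=
    fun s t => (BoundedFormula.IsAtomic.equal _ _).isQF
  refine ⟨?_⟩
  rintro _ ⟨a, rfl⟩
  cases a <;> simp only [OVSAxiom.toSentence] <;>
  repeat' first
    | exact (heq _ _).isUniversal
    | exact (hlt _ _).isUniversal
    | exact (hlt _ _).not.isUniversal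
    | exact ((hlt _ _).imp (hlt _ _)).isUniversal
    | exact ((hlt _ _).imp ((hlt _ _).imp (hlt _ _))).isUniversal
    | exact ((hlt _ _).sup ((heq _ _).sup (hlt _ _))).isUniversal
    | apply BoundedFormula.IsUniversal.all

/-- The structure on an ordered field in which the symbols have their usual meaning. -/
@[reducible]
def fieldOVSStructure (F : Type) [Field F] [LinearOrder F] : (ovsLang F).Structure F where
  funMap
    | .zero, _ => 0
    | .one, _ => 1
    | .add, x => x 0 + x 1
    | .smul k, x => k * x 0
  RelMap
    | .lt, x => x 0 < x 1

theorem models_fieldOVSStructure (F : Type) [Field F] [LinearOrder F] [IsStrictOrderedRing F] :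
    letI := fieldOVSStructure F
    F ⊨ ovsTheory F := by
  let _ := fieldOVSStructure F
  have _ : IsOVS F F :=
    { ovsZero_eq := rfl
      ovsAdd_eq := fun _ _ => rfl
      ovsSmul_eq := fun _ _ => rfl
      ovsLt_iff := fun _ _ => Iff.rfl
      smul_pos := fun _ _ => mul_pos
      one_pos := zero_lt_one (α := F) }
  exact IsOVS.models

end Models

/-! ### Quantifier elimination for ordered vector spaces -/

section Eliminating

universe u

/-- Substitution for the free and the indexed variables at once, possibly changing the number of the
latter. Replacing the last indexed variable by a test term is the case needed for eliminating a
quantifier. -/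
theorem exists_isQF_subst {L : FirstOrder.Language.{0, 0}} {α : Type u} {n : ℕ}
    {m : ℕ} {φ : L.BoundedFormula α m} (hφ : φ.IsQF) (f : α ⊕ Fin m → L.Term (α ⊕ Fin n)) :
    ∃ ψ : L.BoundedFormula α n, ψ.IsQF ∧ ∀ (M : Type w) [L.Structure M] (v : α → M)
      (xs : Fin n → M), ψ.Realize v xs ↔
        φ.Realize (fun a => (f (.inl a)).realize (Sum.elim v xs))
          (fun i => (f (.inr i)).realize (Sum.elim v xs)) := by
  have key : ∀ (M : Type w) [L.Structure M] (v : α → M) (xs : Fin n → M)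
      (t : L.Term (α ⊕ Fin m)), t.realize (Sum.elim
        (fun a => (f (.inl a)).realize (Sum.elim v xs))
          (fun i => (f (.inr i)).realize (Sum.elim v xs))) =
        (t.subst f).realize (Sum.elim v xs) := by
    intro M _ v xs t
    rw [Term.realize_subst]
    congr 1
    ext (a | i) <;> rfl
  induction hφ with
  | falsum => exact ⟨⊥, BoundedFormula.isQF_bot, fun M _ v xs => Iff.rfl⟩
  | of_isAtomic h =>
    cases h with
    | equal t₁ t₂ =>
      refine ⟨(t₁.subst f).bdEqual (t₂.subst f), (BoundedFormula.IsAtomic.equal _ _).isQF,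
        fun M _ v xs => ?_⟩
      simp only [BoundedFormula.realize_bdEqual, key]
    | rel R ts =>
      refine ⟨R.boundedFormula fun i => (ts i).subst f, (BoundedFormula.IsAtomic.rel _ _).isQF,
        fun M _ v xs => ?_⟩
      simp only [BoundedFormula.realize_rel, key]
  | imp _ _ ih₁ ih₂ =>
    obtain ⟨ψ₁, h₁, h₁'⟩ := ih₁
    obtain ⟨ψ₂, h₂, h₂'⟩ := ih₂
    exact ⟨ψ₁.imp ψ₂, h₁.imp h₂, fun M _ v xs => by
      simp only [BoundedFormula.realize_imp, h₁', h₂']⟩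

theorem exists_isQF_disjunction {L : FirstOrder.Language.{0, 0}} {α : Type u} {n : ℕ}
    {φ : L.BoundedFormula α (n + 1)} (hφ : φ.IsQF) {T : Set (L.Term (α ⊕ Fin n))}
    (hT : T.Finite) :
    ∃ ψ : L.BoundedFormula α n, ψ.IsQF ∧ ∀ (M : Type w) [L.Structure M] (v : α → M)
      (xs : Fin n → M), ψ.Realize v xs ↔
        ∃ t ∈ T, φ.Realize v (Fin.snoc xs (t.realize (Sum.elim v xs)) : Fin (n + 1) → M) := by
  induction T, hT using Set.Finite.induction_on with
  | empty => exact ⟨⊥, BoundedFormula.isQF_bot, fun M _ v xs => by simp⟩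
  | @insert t T _ _ ih =>
    obtain ⟨ψ, hψ, h⟩ := ih
    obtain ⟨ψ', hψ', h'⟩ := exists_isQF_subst.{w} hφ
      (Sum.elim (fun a => Term.var (.inl a))
        (Fin.snoc (α := fun _ => L.Term (α ⊕ Fin n)) (fun i => Term.var (.inr i)) t))
    refine ⟨ψ' ⊔ ψ, hψ'.sup hψ, fun M _ v xs => ?_⟩
    rw [BoundedFormula.realize_sup, h, h']
    simp only [Set.mem_insert_iff, exists_eq_or_imp]
    refine or_congr (iff_of_eq ?_) Iff.rfl
    congr 1
    ext i
    refine Fin.lastCases ?_ (fun i => ?_) i <;> simp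

end Eliminating

/-! ### Positions of a point relative to finitely many terms -/

section OVS

universe u

theorem realize_oneTerm {F : Type} {β : Type u} {M : Type w} [(ovsLang F).Structure M]
    (v : β → M) : (Constants.term (oneSymb (F := F))).realize v = ovsOne F M := by
  rw [Term.realize_constants]
  rfl

variable {F : Type} [Field F] [LinearOrder F]

instance {M : Type w} [(ovsLang F).Structure M] [AddCommGroup M] [Module F M] [LinearOrder M]
    [IsOVS F M] : PosSMulStrictMono F M where
  smul_lt_smul_of_pos_left k hk a b hab := by
    have := IsOVS.smul_pos k (b - a) hk (sub_pos.2 hab)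
    rwa [smul_sub, sub_pos] at this

/-- `y` and `y'` lie on the same side of `r`. -/
def SameSide {M : Type w} [LinearOrder M] (r y y' : M) : Prop :=
  (y < r ↔ y' < r) ∧ (r < y ↔ r < y')

theorem SameSide.eq_iff {M : Type w} [LinearOrder M] {r y y' : M} (h : SameSide r y y') :
    y = r ↔ y' = r := by
  rw [eq_iff_le_not_lt, eq_iff_le_not_lt, ← not_lt, ← not_lt, h.1, h.2]

theorem SameSide.smul_lt_iff [IsStrictOrderedRing F] {M : Type w} [AddCommGroup M] [Module F M]
    [LinearOrder M] [IsOrderedAddMonoid M] [PosSMulStrictMono F M] {c : F} (hc : c ≠ 0)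
    {z y y' : M} (h : SameSide (c⁻¹ • z) y y') :
    (c • y < z ↔ c • y' < z) ∧ (z < c • y ↔ z < c • y') ∧ (c • y = z ↔ c • y' = z) := by
  have hneg : ∀ y : M, -c • y = -(c • y) := fun y => neg_smul c y
  -- For negative `c`, comparing `c • y` with `z` is comparing `-c • y` with `-z` in reverse; the
  -- root is the same.
  have hinv : (-c)⁻¹ • -z = c⁻¹ • z := by rw [inv_neg, neg_smul_neg]
  refine ⟨?_, ?_, ?_⟩
  · rcases hc.lt_or_gt with hc | hc
    · have := h.2
      rwa [← hinv, inv_smul_lt_iff_of_pos (neg_pos.2 hc), inv_smul_lt_iff_of_pos (neg_pos.2 hc),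
        hneg, hneg, neg_lt_neg_iff, neg_lt_neg_iff] at this
    · have := h.1
      rwa [lt_inv_smul_iff_of_pos hc, lt_inv_smul_iff_of_pos hc] at this
  · rcases hc.lt_or_gt with hc | hc
    · have := h.1
      rwa [← hinv, lt_inv_smul_iff_of_pos (neg_pos.2 hc), lt_inv_smul_iff_of_pos (neg_pos.2 hc),
        hneg, hneg, neg_lt_neg_iff, neg_lt_neg_iff] at this
    · have := h.2
      rwa [inv_smul_lt_iff_of_pos hc, inv_smul_lt_iff_of_pos hc] at this
  · have := h.eq_iff
    rwa [eq_inv_smul_iff₀ hc, eq_inv_smul_iff₀ hc] at this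

/-- The term `λ_k(t)`. -/
abbrev smulTerm {β : Type u} (k : F) (t : (ovsLang F).Term β) : (ovsLang F).Term β :=
  (smulSymb k).apply₁ t

/-- The term `s + t`. -/
abbrev addTerm {β : Type u} (s t : (ovsLang F).Term β) : (ovsLang F).Term β :=
  addSymb.apply₂ s t

section Realize

variable {β : Type u} {M : Type w} [(ovsLang F).Structure M] [AddCommGroup M] [Module F M]
  [LinearOrder M] [IsOVS F M] (v : β → M)

theorem realize_addTerm (s t : (ovsLang F).Term β) :
    (addTerm s t).realize v = s.realize v + t.realize v := by
  rw [← IsOVS.ovsAdd_eq (F := F)]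
  simp [ovsAdd, addTerm]

theorem realize_smulTerm (k : F) (t : (ovsLang F).Term β) :
    (smulTerm k t).realize v = k • t.realize v := by
  rw [← IsOVS.ovsSmul_eq]
  simp [ovsSmul, smulTerm]

theorem realize_zeroTerm : (Constants.term (zeroSymb (F := F))).realize v = (0 : M) := by
  rw [← IsOVS.ovsZero_eq (F := F), Term.realize_constants]
  rfl

end Realize

/-- Terms are affine in each variable. The coefficient and the remainder are chosen before the
model, which keeps the elimination uniform; `f` tells which variables are to be read as `y`. -/
theorem exists_term_coeff {β γ : Type u} (f : γ → β ⊕ Unit) (t : (ovsLang F).Term γ) :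
    ∃ (c : F) (s : (ovsLang F).Term β), ∀ (M : Type w) [(ovsLang F).Structure M]
      [AddCommGroup M] [Module F M] [LinearOrder M] [IsOVS F M] (v : β → M) (y : M),
      t.realize (Sum.elim v (fun _ => y) ∘ f) = c • y + s.realize v := by
  induction t with
  | var g =>
    cases hg : f g with
    | inl b => exact ⟨0, Term.var b, fun M _ _ _ _ _ v y => by simp [hg]⟩
    | inr b =>
      exact ⟨1, Constants.term zeroSymb, fun M _ _ _ _ _ v y => by
        simp only [realize_zeroTerm]; simp [hg]⟩
  | @func l g ts ih =>
    cases g with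
    | zero =>
      refine ⟨0, Constants.term zeroSymb, fun M _ _ _ _ _ v y => ?_⟩
      rw [realize_zeroTerm, zero_smul, zero_add, ← IsOVS.ovsZero_eq (F := F)]
      exact congrArg (Structure.funMap (zeroSymb (F := F))) (Subsingleton.elim _ _)
    | one =>
      refine ⟨0, Constants.term oneSymb, fun M _ _ _ _ _ v y => ?_⟩
      rw [realize_oneTerm, zero_smul, zero_add]
      exact congrArg (Structure.funMap (oneSymb (F := F))) (Subsingleton.elim _ _)
    | add =>
      obtain ⟨c₀, s₀, h₀⟩ := ih 0
      obtain ⟨c₁, s₁, h₁⟩ := ih 1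
      refine ⟨c₀ + c₁, addTerm s₀ s₁, fun M _ _ _ _ _ v y => ?_⟩
      have : (fun i => (ts i).realize (Sum.elim v (fun _ => y) ∘ f)) =
          ![c₀ • y + s₀.realize v, c₁ • y + s₁.realize v] := by
        ext i; fin_cases i <;> simp [h₀, h₁]
      refine (congrArg (Structure.funMap (addSymb (F := F))) this).trans
        ((IsOVS.ovsAdd_eq (F := F) _ _).trans ?_)
      rw [realize_addTerm, add_smul]
      abel
    | smul k =>
      obtain ⟨c₀, s₀, h₀⟩ := ih 0
      refine ⟨k * c₀, smulTerm k s₀, fun M _ _ _ _ _ v y => ?_⟩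
      have : (fun i => (ts i).realize (Sum.elim v (fun _ => y) ∘ f)) =
          ![c₀ • y + s₀.realize v] := by
        ext i; fin_cases i; simp [h₀]
      refine (congrArg (Structure.funMap (smulSymb k)) this).trans
        ((IsOVS.ovsSmul_eq k _).trans ?_)
      rw [realize_smulTerm, smul_add, mul_smul]

variable [IsStrictOrderedRing F]

/-- The truth of a quantifier-free formula depends only on the position of the variable `y`
relative to finitely many terms in the other variables. -/
theorem exists_roots {β α : Type u} {n : ℕ} (f : α ⊕ Fin n → β ⊕ Unit)
    {φ : (ovsLang F).BoundedFormula α n} (hφ : φ.IsQF) :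
    ∃ ρ : Set ((ovsLang F).Term β), ρ.Finite ∧ ∀ (M : Type w) [(ovsLang F).Structure M]
      [AddCommGroup M] [Module F M] [LinearOrder M] [IsOVS F M] (v : β → M) (y y' : M),
      (∀ r ∈ ρ, SameSide (r.realize v) y y') →
      (φ.Realize (Sum.elim v (fun _ => y) ∘ f ∘ .inl) (Sum.elim v (fun _ => y) ∘ f ∘ .inr) ↔
       φ.Realize (Sum.elim v (fun _ => y') ∘ f ∘ .inl) (Sum.elim v (fun _ => y') ∘ f ∘ .inr)) := by
  have atom : ∀ t₁ t₂ : (ovsLang F).Term (α ⊕ Fin n),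
      ∃ ρ : Set ((ovsLang F).Term β), ρ.Finite ∧ ∀ (M : Type w) [(ovsLang F).Structure M]
      [AddCommGroup M] [Module F M] [LinearOrder M] [IsOVS F M] (v : β → M) (y y' : M),
      (∀ r ∈ ρ, SameSide (r.realize v) y y') →
      ((t₁.realize (Sum.elim v (fun _ => y) ∘ f) = t₂.realize (Sum.elim v (fun _ => y) ∘ f) ↔
      t₁.realize (Sum.elim v (fun _ => y') ∘ f) = t₂.realize (Sum.elim v (fun _ => y') ∘ f)) ∧
      (t₁.realize (Sum.elim v (fun _ => y) ∘ f) < t₂.realize (Sum.elim v (fun _ => y) ∘ f) ↔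
      t₁.realize (Sum.elim v (fun _ => y') ∘ f) < t₂.realize (Sum.elim v (fun _ => y') ∘ f))) := by
    intro t₁ t₂
    obtain ⟨c₁, s₁, h₁⟩ := exists_term_coeff.{w} f t₁
    obtain ⟨c₂, s₂, h₂⟩ := exists_term_coeff.{w} f t₂
    -- With equal coefficients `y` cancels and there is no root; otherwise the single root is `(c₁ -
    -- c₂)⁻¹ • (s₂ - s₁)`.
    by_cases hc : c₁ - c₂ = 0
    · refine ⟨∅, Set.finite_empty, fun M _ _ _ _ _ v y y' _ => ?_⟩
      simp [h₁, h₂, sub_eq_zero.1 hc]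
    · refine ⟨{smulTerm (c₁ - c₂)⁻¹ (addTerm s₂ (smulTerm (-1) s₁))}, Set.finite_singleton _,
        fun M _ _ _ _ _ v y y' h => ?_⟩
      have h := h _ rfl
      rw [realize_smulTerm, realize_addTerm, realize_smulTerm, neg_one_smul] at h
      have := h.smul_lt_iff hc
      have e : ∀ y : M, (c₁ • y + s₁.realize v = c₂ • y + s₂.realize v ↔
          (c₁ - c₂) • y = s₂.realize v + -s₁.realize v) := fun y => by
        rw [sub_smul, sub_eq_iff_eq_add, add_right_comm, ← sub_eq_add_neg, eq_sub_iff_add_eq,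
          add_comm (s₂.realize v)]
      have e' : ∀ y : M, (c₁ • y + s₁.realize v < c₂ • y + s₂.realize v ↔
          (c₁ - c₂) • y < s₂.realize v + -s₁.realize v) := fun y => by
        rw [sub_smul, sub_lt_iff_lt_add, add_right_comm, ← sub_eq_add_neg, lt_sub_iff_add_lt,
          add_comm (s₂.realize v)]
      simp only [h₁, h₂, e, e']
      exact ⟨this.2.2, this.1⟩
  have elim : ∀ {M : Type w} (v : β → M) (y : M), Sum.elim (Sum.elim v (fun _ => y) ∘ f ∘ .inl)
      (Sum.elim v (fun _ => y) ∘ f ∘ .inr) = Sum.elim v (fun _ => y) ∘ f := by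
    intro M v y
    ext (a | i) <;> rfl
  induction hφ with
  | falsum => exact ⟨∅, Set.finite_empty, fun M _ _ _ _ _ v y y' _ => Iff.rfl⟩
  | of_isAtomic h =>
    cases h with
    | equal t₁ t₂ =>
      obtain ⟨ρ, hρ, h⟩ := atom t₁ t₂
      refine ⟨ρ, hρ, fun M _ _ _ _ _ v y y' hy => ?_⟩
      simp only [BoundedFormula.realize_bdEqual, elim]
      exact (h M v y y' hy).1
    | rel R ts =>
      cases R
      obtain ⟨ρ, hρ, h⟩ := atom (ts 0) (ts 1)
      refine ⟨ρ, hρ, fun M _ _ _ _ _ v y y' hy => ?_⟩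
      have e : ∀ (v : α → M) (xs : Fin n → M),
          ((ltSymb (F := F)).boundedFormula ts).Realize v xs ↔
            (ts 0).realize (Sum.elim v xs) < (ts 1).realize (Sum.elim v xs) := fun v xs => by
        rw [BoundedFormula.realize_rel, ← IsOVS.ovsLt_iff (F := F), ovsLt, relOf]
        exact iff_of_eq (congrArg _ (List.ofFn_inj.1 rfl))
      refine (e _ _).trans (Iff.trans ?_ (e _ _).symm)
      rw [elim, elim]
      exact (h M v y y' hy).2
  | imp _ _ ih₁ ih₂ =>
    obtain ⟨ρ₁, hρ₁, h₁⟩ := ih₁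
    obtain ⟨ρ₂, hρ₂, h₂⟩ := ih₂
    refine ⟨ρ₁ ∪ ρ₂, hρ₁.union hρ₂, fun M _ _ _ _ _ v y y' hy => ?_⟩
    rw [BoundedFormula.realize_imp, BoundedFormula.realize_imp,
      h₁ M v y y' fun r hr => hy r (.inl hr), h₂ M v y y' fun r hr => hy r (.inr hr)]

/-- Candidates for the relative positions of a point and the elements of a finite set. -/
theorem exists_sameSide {M : Type w} [AddCommGroup M] [Module F M] [LinearOrder M]
    [IsOrderedAddMonoid M] [PosSMulStrictMono F M] {e : M} (he : 0 < e) {S : Set M}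
    (hS : S.Finite) (y : M) :
    ∃ z, (z ∈ S ∨ (∃ a ∈ S, ∃ b ∈ S, z = (2⁻¹ : F) • (a + b)) ∨ (∃ a ∈ S, z = a + e) ∨
      (∃ a ∈ S, z = a + (-1 : F) • e) ∨ z = 0) ∧ ∀ s ∈ S, SameSide s y z := by
  by_cases hy : y ∈ S
  · exact ⟨y, .inl hy, fun s _ => ⟨Iff.rfl, Iff.rfl⟩⟩
  have hne : ∀ s ∈ S, s < y ∨ y < s := fun s hs => lt_or_gt_of_ne fun h => hy (h ▸ hs)
  have key : ∀ z, (∀ s ∈ S, (s < y → s < z) ∧ (y < s → z < s)) → ∀ s ∈ S, SameSide s y z := by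
    intro z hz s hs
    rcases hne s hs with h | h
    · have := (hz s hs).1 h
      exact ⟨iff_of_false h.not_gt this.not_gt, iff_of_true h this⟩
    · have := (hz s hs).2 h
      exact ⟨iff_of_true h this, iff_of_false h.not_gt this.not_gt⟩
  have hlow := Set.exists_max_image {s ∈ S | s < y} id (hS.subset (Set.sep_subset _ _))
  have hup := Set.exists_min_image {s ∈ S | y < s} id (hS.subset (Set.sep_subset _ _))
  rcases Set.eq_empty_or_nonempty {s ∈ S | s < y} with hl | hl <;>
    rcases Set.eq_empty_or_nonempty {s ∈ S | y < s} with hu | hu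
  -- Nothing in `S` is below or above `y`, and `y ∉ S`, so `S` is empty and any point will do.
  · refine ⟨0, by tauto, key _ fun s hs => ?_⟩
    exact ⟨fun h => (Set.eq_empty_iff_forall_notMem.1 hl s ⟨hs, h⟩).elim,
      fun h => (Set.eq_empty_iff_forall_notMem.1 hu s ⟨hs, h⟩).elim⟩
  · obtain ⟨b, hb, hbmin⟩ := hup hu
    refine ⟨b + (-1 : F) • e, .inr (.inr (.inr (.inl ⟨b, hb.1, rfl⟩))), key _ fun s hs => ?_⟩
    refine ⟨fun h => (Set.eq_empty_iff_forall_notMem.1 hl s ⟨hs, h⟩).elim,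
      fun h => lt_of_lt_of_le ?_ (hbmin s ⟨hs, h⟩)⟩
    simpa using he
  · obtain ⟨a, ha, hamax⟩ := hlow hl
    refine ⟨a + e, .inr (.inr (.inl ⟨a, ha.1, rfl⟩)), key _ fun s hs => ?_⟩
    refine ⟨fun h => lt_of_le_of_lt (hamax s ⟨hs, h⟩) ?_,
      fun h => (Set.eq_empty_iff_forall_notMem.1 hu s ⟨hs, h⟩).elim⟩
    simpa using he
  · obtain ⟨a, ha, hamax⟩ := hlow hl
    obtain ⟨b, hb, hbmin⟩ := hup hu
    have hab : a < b := ha.2.trans hb.2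
    have h2 : (0 : F) < 2 := two_pos
    refine ⟨(2⁻¹ : F) • (a + b), .inr (.inl ⟨a, ha.1, b, hb.1, rfl⟩), key _ fun s hs => ?_⟩
    refine ⟨fun h => lt_of_le_of_lt (hamax s ⟨hs, h⟩) ?_,
      fun h => lt_of_lt_of_le ?_ (hbmin s ⟨hs, h⟩)⟩
    · rw [id, lt_inv_smul_iff_of_pos h2, two_smul]
      simpa using hab
    · rw [id, inv_smul_lt_iff_of_pos h2, two_smul]
      simpa using hab

/-- Finitely many terms in the remaining variables suffice to witness an existential
quantifier. -/
theorem exists_testTerms {β : Type u} {ρ : Set ((ovsLang F).Term β)} (hρ : ρ.Finite) :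
    ∃ T : Set ((ovsLang F).Term β), T.Finite ∧ ∀ (M : Type w) [(ovsLang F).Structure M]
      [AddCommGroup M] [Module F M] [LinearOrder M] [IsOVS F M] (v : β → M) (y : M),
      ∃ t ∈ T, ∀ r ∈ ρ, SameSide (r.realize v) y (t.realize v) := by
  refine ⟨ρ ∪ Set.image2 (fun a b => smulTerm 2⁻¹ (addTerm a b)) ρ ρ ∪
    (fun a => addTerm a (Constants.term oneSymb)) '' ρ ∪
    (fun a => addTerm a (smulTerm (-1) (Constants.term oneSymb))) '' ρ ∪
    {Constants.term zeroSymb}, ?_, fun M _ _ _ _ _ v y => ?_⟩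
  · exact (((hρ.union (hρ.image2 _ hρ)).union (hρ.image _)).union (hρ.image _)).union
      (Set.finite_singleton _)
  · obtain ⟨z, hz, h⟩ := exists_sameSide (F := F) (IsOVS.one_pos (F := F) (M := M))
      (hρ.image fun r => r.realize v) y
    suffices ∃ t : (ovsLang F).Term β, t ∈ _ ∧ t.realize v = z by
      obtain ⟨t, ht, rfl⟩ := this
      exact ⟨t, ht, fun r hr => h _ ⟨r, hr, rfl⟩⟩
    rcases hz with ⟨r, hr, rfl⟩ | ⟨_, ⟨r, hr, rfl⟩, _, ⟨r', hr', rfl⟩, rfl⟩ |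
      ⟨_, ⟨r, hr, rfl⟩, rfl⟩ | ⟨_, ⟨r, hr, rfl⟩, rfl⟩ | rfl
    · exact ⟨r, .inl (.inl (.inl (.inl hr))), rfl⟩
    · exact ⟨_, .inl (.inl (.inl (.inr ⟨r, hr, r', hr', rfl⟩))), by
        rw [realize_smulTerm, realize_addTerm]⟩
    · exact ⟨_, .inl (.inl (.inr ⟨r, hr, rfl⟩)), by rw [realize_addTerm, realize_oneTerm]⟩
    · exact ⟨_, .inl (.inr ⟨r, hr, rfl⟩), by
        rw [realize_addTerm, realize_smulTerm, realize_oneTerm]⟩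
    · exact ⟨_, .inr rfl, realize_zeroTerm v⟩

/-- Quantifier elimination. -/
theorem exists_isQF {α : Type u} {n : ℕ} (φ : (ovsLang F).BoundedFormula α n) :
    ∃ ψ : (ovsLang F).BoundedFormula α n, ψ.IsQF ∧ ∀ (M : Type w) [(ovsLang F).Structure M]
      [AddCommGroup M] [Module F M] [LinearOrder M] [IsOVS F M] (v : α → M) (xs : Fin n → M),
      φ.Realize v xs ↔ ψ.Realize v xs := by
  induction φ with
  | falsum => exact ⟨_, BoundedFormula.isQF_bot, fun M _ _ _ _ _ v xs => Iff.rfl⟩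
  | equal t₁ t₂ =>
    exact ⟨_, (BoundedFormula.IsAtomic.equal t₁ t₂).isQF, fun M _ _ _ _ _ v xs => Iff.rfl⟩
  | rel R ts => exact ⟨_, (BoundedFormula.IsAtomic.rel R ts).isQF, fun M _ _ _ _ _ v xs => Iff.rfl⟩
  | imp φ₁ φ₂ ih₁ ih₂ =>
    obtain ⟨ψ₁, h₁, h₁'⟩ := ih₁
    obtain ⟨ψ₂, h₂, h₂'⟩ := ih₂
    exact ⟨ψ₁.imp ψ₂, h₁.imp h₂, fun M _ _ _ _ _ v xs => by
      simp only [BoundedFormula.realize_imp, h₁', h₂']⟩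
  | @all n φ ih =>
    obtain ⟨ψ, hψ, h⟩ := ih
    -- The last indexed variable, the one being quantified, becomes `y`; all others become
    -- parameters.
    let f : α ⊕ Fin (n + 1) → (α ⊕ Fin n) ⊕ Unit :=
      Sum.elim (fun a => .inl (.inl a))
        (Fin.snoc (α := fun _ => (α ⊕ Fin n) ⊕ Unit) (fun i => .inl (.inr i)) (.inr ()))
    obtain ⟨ρ, hρ, hroots⟩ := exists_roots.{w} f hψ
    obtain ⟨T, hT, htest⟩ := exists_testTerms.{w} hρ
    -- `χ` says that some test term is a counterexample, so its negation expresses the universal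
    -- quantifier.
    obtain ⟨χ, hχ, hχ'⟩ := exists_isQF_disjunction.{w} hψ.not hT
    refine ⟨χ.not, hχ.not, fun M _ _ _ _ _ v xs => ?_⟩
    have key : ∀ y y' : M, (∀ r ∈ ρ, SameSide (r.realize (Sum.elim v xs)) y y') →
        (ψ.Realize v (Fin.snoc xs y) ↔ ψ.Realize v (Fin.snoc xs y')) := by
      intro y y' hy
      have e : ∀ y : M, Sum.elim (Sum.elim v xs) (fun _ => y) ∘ f ∘ .inr = Fin.snoc xs y := by
        intro y
        ext i
        refine Fin.lastCases ?_ (fun i => ?_) i <;> simp [f]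
      have := hroots M (Sum.elim v xs) y y' hy
      rwa [e, e] at this
    simp only [BoundedFormula.realize_all, BoundedFormula.realize_not, hχ', h]
    constructor
    · rintro hall ⟨t, -, ht⟩
      exact ht (hall _)
    · intro hex y
      obtain ⟨t, ht, hty⟩ := htest M (Sum.elim v xs) y
      by_contra hy
      exact hex ⟨t, ht, fun h => hy ((key _ _ hty).2 h)⟩

end OVS

/-! ### Definable sets in ordered vector spaces -/

section DefinableSets

universe u

theorem definable₁_iff_exists_formulaOver {L : FirstOrder.Language.{0, 0}} {M : Type w}
    [L.Structure M] {C S : Set M} :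
    C.Definable₁ L S ↔ ∃ φ : FormulaOver L C, S = {b | SatOver φ b} := by
  rw [Set.Definable₁, Set.definable_iff_exists_formula_sum]
  constructor
  · rintro ⟨φ, hφ⟩
    refine ⟨φ.relabel (Sum.map id fun _ => ()), ?_⟩
    ext b
    have := Set.ext_iff.1 hφ (fun _ => b)
    rw [Set.mem_ofPred_eq] at this
    refine this.trans ?_
    rw [Set.mem_ofPred_eq, Set.mem_ofPred_eq, SatOver, Formula.realize_relabel]
    refine iff_of_eq (congrArg _ ?_)
    ext (a | i) <;> rfl
  · rintro ⟨φ, rfl⟩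
    refine ⟨φ.relabel (Sum.map id fun _ => 0), ?_⟩
    ext x
    rw [Set.mem_ofPred_eq, Set.mem_ofPred_eq, Set.mem_ofPred_eq, SatOver, Formula.realize_relabel]
    refine iff_of_eq (congrArg _ ?_)
    ext (a | i) <;> rfl

variable {F : Type} [Field F] [LinearOrder F]

theorem IsOVS.isDLO {M : Type w} [(ovsLang F).Structure M] [AddCommGroup M] [Module F M]
    [LinearOrder M] [IsStrictOrderedRing F] [IsOVS F M] :
    IsDLO (relOf (ltSymb (F := F)) : M → M → Prop) := by
  have h : ∀ a b : M, relOf (ltSymb (F := F)) a b ↔ a < b := IsOVS.ovsLt_iff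
  have h1 : 0 < ovsOne F M := IsOVS.one_pos
  constructor <;> simp only [h]
  · exact lt_irrefl
  · exact fun a b c => lt_trans
  · exact lt_trichotomy
  · intro a b hab
    have h2 : (0 : F) < 2 := two_pos
    refine ⟨(2⁻¹ : F) • (a + b), ?_, ?_⟩
    · rw [lt_inv_smul_iff_of_pos h2, two_smul]
      simpa using hab
    · rw [inv_smul_lt_iff_of_pos h2, two_smul]
      simpa using hab
  · exact fun a => ⟨a - ovsOne F M, by simpa using h1⟩
  · exact fun a => ⟨a + ovsOne F M, by simpa using h1⟩

theorem extendsDLO_ovsTheory [IsStrictOrderedRing F] :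
    ExtendsDLO.{w} (ovsTheory F) (ltSymb (F := F)) := by
  intro M _ _ hM
  obtain ⟨_, _, _, _⟩ := exists_isOVS hM
  exact IsOVS.isDLO

theorem term_realize_mem_span {β : Type u} {M : Type w} [(ovsLang F).Structure M]
    [AddCommGroup M] [Module F M] [LinearOrder M] [IsOVS F M] (v : β → M)
    (t : (ovsLang F).Term β) :
    t.realize v ∈ Submodule.span F (insert (ovsOne F M) (Set.range v)) := by
  induction t with
  | var b => exact Submodule.subset_span (.inr ⟨b, rfl⟩)
  | @func l g ts ih =>
    cases g with
    | zero =>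
      have : (Term.func OVSFunc.zero ts : (ovsLang F).Term β).realize v = 0 :=
        Eq.trans (b := ovsZero F M)
          (congrArg (Structure.funMap (zeroSymb (F := F))) (Subsingleton.elim _ _))
          IsOVS.ovsZero_eq
      rw [this]
      exact Submodule.zero_mem _
    | one =>
      have : (Term.func OVSFunc.one ts : (ovsLang F).Term β).realize v = ovsOne F M :=
        congrArg (Structure.funMap (oneSymb (F := F))) (Subsingleton.elim _ _)
      rw [this]
      exact Submodule.subset_span (.inl rfl)
    | add =>
      have e : (fun i => (ts i).realize v) = ![(ts 0).realize v, (ts 1).realize v] := by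
        ext i; fin_cases i <;> rfl
      have : (Term.func OVSFunc.add ts : (ovsLang F).Term β).realize v =
          (ts 0).realize v + (ts 1).realize v :=
        (congrArg (Structure.funMap (addSymb (F := F))) e).trans (IsOVS.ovsAdd_eq (F := F) _ _)
      rw [this]
      exact Submodule.add_mem _ (ih 0) (ih 1)
    | smul k =>
      have e : (fun i => (ts i).realize v) = ![(ts 0).realize v] := by
        ext i; fin_cases i; rfl
      have : (Term.func (OVSFunc.smul k) ts : (ovsLang F).Term β).realize v =
          k • (ts 0).realize v :=
        (congrArg (Structure.funMap (smulSymb k)) e).trans (IsOVS.ovsSmul_eq k _)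
      rw [this]
      exact Submodule.smul_mem _ _ (ih 0)

theorem mem_span_iff_exists_term {β : Type u} {M : Type w} [(ovsLang F).Structure M]
    [AddCommGroup M] [Module F M] [LinearOrder M] [IsOVS F M] (v : β → M) (b : M) :
    b ∈ Submodule.span F (insert (ovsOne F M) (Set.range v)) ↔
      ∃ t : (ovsLang F).Term β, t.realize v = b := by
  constructor
  · intro hb
    induction hb using Submodule.span_induction with
    | mem x hx =>
      rcases hx with rfl | ⟨b, rfl⟩
      exacts [⟨_, realize_oneTerm v⟩, ⟨Term.var b, rfl⟩]
    | zero => exact ⟨_, realize_zeroTerm v⟩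
    | add x y _ _ hx hy =>
      obtain ⟨s, rfl⟩ := hx
      obtain ⟨t, rfl⟩ := hy
      exact ⟨_, realize_addTerm v s t⟩
    | smul k x _ hx =>
      obtain ⟨s, rfl⟩ := hx
      exact ⟨_, realize_smulTerm v k s⟩
  · rintro ⟨t, rfl⟩
    exact term_realize_mem_span v t

variable [IsStrictOrderedRing F]

theorem exists_roots_formula {β : Type u} (φ : (ovsLang F).Formula (β ⊕ Unit)) :
    ∃ ρ : Set ((ovsLang F).Term β), ρ.Finite ∧ ∀ (M : Type w) [(ovsLang F).Structure M]
      [AddCommGroup M] [Module F M] [LinearOrder M] [IsOVS F M] (v : β → M) (y y' : M),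
      (∀ r ∈ ρ, SameSide (r.realize v) y y') →
      (φ.Realize (Sum.elim v fun _ => y) ↔ φ.Realize (Sum.elim v fun _ => y')) := by
  obtain ⟨ψ, hψ, h⟩ := exists_isQF.{w} φ
  let f : (β ⊕ Unit) ⊕ Fin 0 → β ⊕ Unit := Sum.elim id Fin.elim0
  obtain ⟨ρ, hρ, hroots⟩ := exists_roots.{w} f hψ
  refine ⟨ρ, hρ, fun M _ _ _ _ _ v y y' hy => ?_⟩
  have e : ∀ y : M, φ.Realize (Sum.elim v fun _ => y) ↔ ψ.Realize
      (Sum.elim v (fun _ : Unit => y) ∘ f ∘ .inl)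
      (Sum.elim v (fun _ : Unit => y) ∘ f ∘ .inr) := fun y => by
    rw [Formula.Realize, h]
    refine iff_of_eq (congrArg _ ?_)
    exact Subsingleton.elim _ _
  rw [e, e]
  exact hroots M v y y' hy

/-- Positions relative to a finite set that are not realized in it are realized in an interval. -/
theorem exists_interval_sameSide {M : Type w} [LinearOrder M] [NoMinOrder M] [NoMaxOrder M]
    {R : Set M} (hR : R.Finite) {y : M} (hy : y ∉ R) :
    ∃ a b, a < y ∧ y < b ∧ ∀ z, a < z → z < b → ∀ r ∈ R, SameSide r y z := by
  induction R, hR using Set.Finite.induction_on with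
  | empty =>
    obtain ⟨a, ha⟩ := exists_lt y
    obtain ⟨b, hb⟩ := exists_gt y
    exact ⟨a, b, ha, hb, by simp⟩
  | @insert r R _ _ ih =>
    rw [Set.mem_insert_iff, not_or] at hy
    obtain ⟨a, b, ha, hb, h⟩ := ih hy.2
    rcases lt_or_gt_of_ne hy.1 with hlt | hlt
    · refine ⟨a, min b r, ha, lt_min hb hlt, fun z hz hz' => ?_⟩
      rintro s (rfl | hs)
      · have := hz'.trans_le (min_le_right _ _)
        exact ⟨iff_of_true hlt this, iff_of_false hlt.not_gt this.not_gt⟩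
      · exact h z hz (hz'.trans_le (min_le_left _ _)) s hs
    · refine ⟨max a r, b, max_lt ha hlt, hb, fun z hz hz' => ?_⟩
      rintro s (rfl | hs)
      · have := (le_max_right _ _).trans_lt hz
        exact ⟨iff_of_false hlt.not_gt this.not_gt, iff_of_true hlt this⟩
      · exact h z ((le_max_left _ _).trans_lt hz) hz' s hs

theorem isPointOrInterval_sameSide {M : Type w} [LinearOrder M] {R : Set M} (hR : R.Finite)
    (y : M) : IsPointOrInterval (· < ·) {z | ∀ r ∈ R, SameSide r y z} := by
  by_cases hy : y ∈ R
  · refine .inl ⟨y, Set.ext fun z => ⟨fun h => (h y hy).eq_iff.1 rfl, ?_⟩⟩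
    rintro rfl r _
    exact ⟨Iff.rfl, Iff.rfl⟩
  -- Excluding points leaves only open intervals, a class closed under intersection with the open
  -- half-lines that the induction adds.
  right
  induction R, hR using Set.Finite.induction_on with
  | empty => exact .inr (.inr (.inr (by simp)))
  | @insert r R _ _ ih =>
    rw [Set.mem_insert_iff, not_or] at hy
    have hset : {z | ∀ s ∈ insert r R, SameSide s y z} =
        {z | ∀ s ∈ R, SameSide s y z} ∩ {z | SameSide r y z} := by
      ext z; simp [and_comm]
    rcases lt_or_gt_of_ne hy.1 with hlt | hlt
    · have hr : {z | SameSide r y z} = {z | z < r} := by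
        ext z
        exact ⟨fun h => h.1.1 hlt, fun h : z < r => ⟨iff_of_true hlt h,
          iff_of_false hlt.not_gt h.not_gt⟩⟩
      rw [hset, hr]
      rcases ih hy.2 with ⟨a, b, h⟩ | ⟨a, h⟩ | ⟨b, h⟩ | h <;> rw [h]
      · exact .inl ⟨a, min b r, by ext; simp [and_assoc]⟩
      · exact .inl ⟨a, r, by ext; simp⟩
      · exact .inr (.inr (.inl ⟨min b r, by ext; simp⟩))
      · exact .inr (.inr (.inl ⟨r, by ext; simp⟩))
    · have hr : {z | SameSide r y z} = {z | r < z} := by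
        ext z
        exact ⟨fun h => h.2.1 hlt, fun h : r < z => ⟨iff_of_false hlt.not_gt h.not_gt,
          iff_of_true hlt h⟩⟩
      rw [hset, hr]
      rcases ih hy.2 with ⟨a, b, h⟩ | ⟨a, h⟩ | ⟨b, h⟩ | h <;> rw [h]
      · exact .inl ⟨max a r, b, by ext; simp; tauto⟩
      · exact .inr (.inl ⟨max a r, by ext; simp⟩)
      · exact .inl ⟨r, b, by ext; simp [and_comm]⟩
      · exact .inr (.inl ⟨r, by ext; simp⟩)

/-- A position is determined by the set of elements of `R` above the point and the set of those
below it, and `R` has finitely many subsets. -/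
theorem finite_range_sameSide {M : Type w} [LinearOrder M] {R : Set M} (hR : R.Finite) :
    (Set.range fun y : M => {z | ∀ r ∈ R, SameSide r y z}).Finite := by
  refine ((hR.finite_subsets.prod hR.finite_subsets).image fun p : Set M × Set M =>
    {z | ∀ r ∈ R, (r ∈ p.1 ↔ z < r) ∧ (r ∈ p.2 ↔ r < z)}).subset ?_
  rintro _ ⟨y, rfl⟩
  refine ⟨({r ∈ R | y < r}, {r ∈ R | r < y}), ⟨Set.sep_subset _ _, Set.sep_subset _ _⟩, ?_⟩
  ext z
  refine forall₂_congr fun r hr => ?_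
  simp [SameSide, hr]

/-- A definable set is the union of the position classes of its members relative to the roots of a
defining formula. -/
theorem oMinimal_ovsTheory : IsOMinimal.{w} (ovsTheory F) (ltSymb (F := F)) := by
  intro M _ _ hM S hS
  obtain ⟨_, _, _, _⟩ := exists_isOVS hM
  obtain ⟨φ, rfl⟩ := definable₁_iff_exists_formulaOver.1 hS
  obtain ⟨ρ, hρ, hroots⟩ := exists_roots_formula.{w} φ
  have hR := hρ.image fun r => r.realize (Subtype.val : (Set.univ (α := M)) → M)
  have hlt : (relOf (ltSymb (F := F)) : M → M → Prop) = (· < ·) := by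
    ext a b
    exact IsOVS.ovsLt_iff a b
  refine ⟨_, (finite_range_sameSide hR).subset
    (Set.image_subset_range _ {b | SatOver φ b}), ?_, ?_⟩
  · rintro _ ⟨y, -, rfl⟩
    rw [hlt]
    exact isPointOrInterval_sameSide hR y
  · ext z
    rw [Set.mem_sUnion]
    constructor
    · exact fun hz => ⟨_, ⟨z, hz, rfl⟩, fun r _ => ⟨Iff.rfl, Iff.rfl⟩⟩
    · rintro ⟨_, ⟨y, hy, rfl⟩, hz⟩
      exact (hroots M Subtype.val y z fun r hr => hz _ ⟨r, hr, rfl⟩).1 hy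

theorem IsOVS.order_instances (F : Type) [Field F] [LinearOrder F] [IsStrictOrderedRing F]
    (M : Type w) [(ovsLang F).Structure M] [AddCommGroup M] [Module F M] [LinearOrder M]
    [IsOVS F M] : DenselyOrdered M ∧ NoMinOrder M ∧ NoMaxOrder M := by
  have h : IsDLO (relOf (ltSymb (F := F)) : M → M → Prop) := IsOVS.isDLO
  have hlt : (relOf (ltSymb (F := F)) : M → M → Prop) = (· < ·) := by
    ext a b
    exact IsOVS.ovsLt_iff a b
  rw [hlt] at h
  exact ⟨⟨h.dense⟩, ⟨h.exists_lt⟩, ⟨h.exists_gt⟩⟩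

section Model

variable {M : Type w} [(ovsLang F).Structure M] [AddCommGroup M] [Module F M] [LinearOrder M]
  [IsOVS F M]

/-- A point that is not a root keeps its position relative to the roots throughout some open
interval around it. -/
theorem mem_roots_or_exists_interval {β : Type u} (φ : (ovsLang F).Formula (β ⊕ Unit)) :
    ∃ ρ : Set ((ovsLang F).Term β), ρ.Finite ∧ ∀ (v : β → M) (y : M),
      φ.Realize (Sum.elim v fun _ => y) → (∃ r ∈ ρ, r.realize v = y) ∨
        ∃ a b, a < y ∧ y < b ∧ ∀ z, a < z → z < b → φ.Realize (Sum.elim v fun _ => z) := by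
  obtain ⟨_, _, _⟩ := IsOVS.order_instances F M
  obtain ⟨ρ, hρ, hroots⟩ := exists_roots_formula.{w} φ
  refine ⟨ρ, hρ, fun v y hy => or_iff_not_imp_left.2 fun hne => ?_⟩
  obtain ⟨a, b, ha, hb, h⟩ := exists_interval_sameSide (hρ.image fun r => r.realize v)
    (y := y) fun ⟨r, hr, hry⟩ => hne ⟨r, hr, hry⟩
  exact ⟨a, b, ha, hb, fun z hz hz' =>
    (hroots M v y z fun r hr => h z hz hz' _ ⟨r, hr, rfl⟩).1 hy⟩

theorem infinite_iff_exists_interval {β : Type u} (φ : (ovsLang F).Formula (β ⊕ Unit))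
    (v : β → M) : {y : M | φ.Realize (Sum.elim v fun _ => y)}.Infinite ↔
      ∃ a b, a < b ∧ ∀ z, a < z → z < b → φ.Realize (Sum.elim v fun _ => z) := by
  obtain ⟨_, _, _⟩ := IsOVS.order_instances F M
  constructor
  · intro hinf
    obtain ⟨ρ, hρ, h⟩ := mem_roots_or_exists_interval (M := M) φ
    obtain ⟨y, hy, hyρ⟩ := hinf.exists_notMem_finite (hρ.image fun r => r.realize v)
    rcases h v y hy with ⟨r, hr, rfl⟩ | ⟨a, b, ha, hb, h⟩
    · exact (hyρ ⟨r, hr, rfl⟩).elim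
    · exact ⟨a, b, ha.trans hb, h⟩
  · rintro ⟨a, b, hab, h⟩
    exact (Set.Ioo_infinite hab).mono fun z hz => h z hz.1 hz.2

theorem exists_term_of_finite {β : Type u} {φ : (ovsLang F).Formula (β ⊕ Unit)} {v : β → M}
    (hfin : {y : M | φ.Realize (Sum.elim v fun _ => y)}.Finite) {b : M}
    (hb : φ.Realize (Sum.elim v fun _ => b)) : ∃ t : (ovsLang F).Term β, t.realize v = b := by
  obtain ⟨ρ, hρ, h⟩ := mem_roots_or_exists_interval (M := M) φ
  rcases h v b hb with ⟨r, -, hr⟩ | ⟨x, y, hx, hy, h⟩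
  · exact ⟨r, hr⟩
  · exact ((infinite_iff_exists_interval φ _).2 ⟨x, y, hx.trans hy, h⟩ hfin).elim

/-- A member of a finite definable set cannot be interior to it, so it is a root, that is, the value
of a term over `C`. Conversely the value of a term is defined by an equation. Values of terms are
exactly the linear combinations of `1` and `C`. -/
theorem acl_eq_span (C : Set M) :
    acl (ovsLang F) C = Submodule.span F (insert (ovsOne F M) C) := by
  ext b
  have hC : C = Set.range (Subtype.val : C → M) := Subtype.range_coe.symm
  constructor
  · rintro ⟨S, hS, hfin, hb⟩
    obtain ⟨φ, rfl⟩ := definable₁_iff_exists_formulaOver.1 hS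
    rw [SetLike.mem_coe, hC, mem_span_iff_exists_term]
    exact exists_term_of_finite hfin hb
  · intro hb
    rw [SetLike.mem_coe, hC, mem_span_iff_exists_term] at hb
    obtain ⟨t, rfl⟩ := hb
    refine ⟨{t.realize Subtype.val}, definable₁_iff_exists_formulaOver.2
      ⟨Term.equal (Term.var (.inr ())) (t.relabel .inl), ?_⟩, Set.finite_singleton _, rfl⟩
    ext y
    simp only [SatOver, Formula.realize_equal, Term.realize_var, Term.realize_relabel]
    exact Iff.rfl

end Model

theorem isPregeometry_span {F : Type} [Field F] {M : Type w} [AddCommGroup M] [Module F M] (e : M) :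
    IsPregeometry fun C : Set M => (Submodule.span F (insert e C) : Set M) where
  subset_cl X x hx := Submodule.subset_span (.inr hx)
  mono X Y h := Submodule.span_mono (Set.insert_subset_insert h)
  idem X := by
    refine le_antisymm (Submodule.span_le.2 (Set.insert_subset_iff.2
      ⟨Submodule.subset_span (.inl rfl), le_rfl⟩)) fun x hx => Submodule.subset_span (.inr hx)
  finitary X a ha := by
    classical
    obtain ⟨T, hT, haT⟩ := Submodule.mem_span_finite_of_mem_span ha
    refine ⟨↑T \ {e}, fun x hx => (hT hx.1).resolve_left hx.2, T.finite_toSet.sdiff, ?_⟩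
    refine Submodule.span_mono (fun x hx => ?_) haT
    by_cases hxe : x = e
    exacts [.inl hxe, .inr ⟨hx, hxe⟩]
  exchange X a b ha ha' := by
    rw [Set.insert_comm] at ha ⊢
    exact mem_span_insert_exchange ha ha'

theorem isGeometric_ovsTheory : IsGeometric.{w} (ovsTheory F) := by
  constructor
  · intro n φ
    -- Indices `0` and `1` are the endpoints of an interval of solutions, and `2` is the point
    -- running through it.
    let g : Fin n ⊕ Unit → Fin n ⊕ Fin 3 := Sum.map id fun _ => 2
    let lt {m : ℕ} (i j : Fin m) : (ovsLang F).BoundedFormula (Fin n) m := fLt (&i) (&j)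
    let χ : (ovsLang F).BoundedFormula (Fin n) 3 := BoundedFormula.relabel g φ
    refine ⟨∃' ∃' (lt 0 1 ⊓ ∀' (lt 0 2 ⟹ lt 2 1 ⟹ χ)), fun M _ _ hM c => ?_⟩
    obtain ⟨_, _, _, _⟩ := exists_isOVS hM
    rw [infinite_iff_exists_interval]
    have hχ : ∀ (xs : Fin 3 → M), χ.Realize c xs ↔ φ.Realize (Sum.elim c fun _ => xs 2) := by
      intro xs
      refine BoundedFormula.realize_relabel.trans ?_
      rw [Formula.Realize]
      refine iff_of_eq ?_
      congr 1
      · ext (i | i) <;> rfl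
      · exact Subsingleton.elim _ _
    simp only [Formula.Realize, BoundedFormula.realize_ex, BoundedFormula.realize_inf,
      BoundedFormula.realize_all, BoundedFormula.realize_imp, hχ, lt, realize_fLt, IsOVS.ovsLt_iff]
    rfl
  · intro M _ _ hM
    obtain ⟨_, _, _, _⟩ := exists_isOVS hM
    have : (acl (ovsLang F) : Set M → Set M) = fun C =>
        (Submodule.span F (insert (ovsOne F M) C) : Set M) := funext acl_eq_span
    rw [this]
    exact isPregeometry_span _

end DefinableSets

/-! ### Pairs -/

section PairSemantics

universe u

variable {Lα Lβ : FirstOrder.Language.{0, 0}} (ι : Lα →ᴸ Lβ) {M : Type w}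

/-- Lets statements about arbitrary models of an `L²`-theory be checked on pairs. -/
theorem exists_eq_pairStructure (S : (pairLang Lβ).Structure M) :
    ∃ (_ : Lβ.Structure M) (A : Set M), S = pairStructure Lβ A := by
  refine ⟨(LHom.sumInl : Lβ →ᴸ pairLang Lβ).reduct M, {x | Structure.RelMap (predA Lβ) ![x]}, ?_⟩
  ext n f x
  · cases f with
    | inl f => rfl
    | inr f => exact f.elim
  · cases f with
    | inl f => rfl
    | inr f =>
      cases f
      have e : x = ![x 0] := by
        ext i; fin_cases i; rfl
      rw [e]
      rfl

section

variable [Lβ.Structure M]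

theorem sumInl_isExpansionOn_pairStructure (A : Set M) :
    letI := pairStructure Lβ A
    (LHom.sumInl : Lβ →ᴸ pairLang Lβ).IsExpansionOn M :=
  letI := predStructure A
  inferInstance

theorem pairRealize_onFormula (A : Set M) {α : Type u} (φ : Lβ.Formula α) (v : α → M) :
    PairRealize A (LHom.sumInl.onFormula φ) v ↔ φ.Realize v :=
  letI := pairStructure Lβ A
  have := sumInl_isExpansionOn_pairStructure (Lβ := Lβ) A
  LHom.realize_onFormula _ φ

theorem pairModels_onTheory (A : Set M) (T : Lβ.Theory) :
    PairModels (LHom.sumInl.onTheory T) M A ↔ M ⊨ T :=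
  letI := pairStructure Lβ A
  have := sumInl_isExpansionOn_pairStructure (Lβ := Lβ) A
  LHom.onTheory_model _ T

theorem pairRealize_formula₁_predA (A : Set M) {α : Type u} (t : (pairLang Lβ).Term α)
    (v : α → M) :
    PairRealize A ((predA Lβ).formula₁ t) v ↔
      letI := pairStructure Lβ A
      t.realize v ∈ A := by
  let _ := pairStructure Lβ A
  refine Formula.realize_rel₁.trans ?_
  exact Iff.rfl

theorem realize_closureSentence_iff (A : Set M) {n : ℕ} (f : Lα.Functions n) :
    PairRealize A (closureSentence (Lβ := Lβ) ι f) default ↔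
      ∀ x : Fin n → M, (∀ i, x i ∈ A) → Structure.funMap (ι.onFunction f) x ∈ A := by
  let _ := pairStructure Lβ A
  unfold PairRealize closureSentence
  rw [Formula.Realize, BoundedFormula.realize_iAlls]
  refine forall_congr' fun x => ?_
  rw [Formula.realize_imp]
  refine imp_congr ?_ ?_
  · rw [Formula.realize_iInf]
    refine forall_congr' fun i => ?_
    exact pairRealize_formula₁_predA A _ _
  · exact pairRealize_formula₁_predA A _ _

/-- The substructure with underlying set `A`. -/
def pairSubstructure [Lα.Structure M] [ι.IsExpansionOn M] (A : Set M)
    (h : ∀ (n : ℕ) (f : Lα.Functions n), PairRealize A (closureSentence (Lβ := Lβ) ι f) default) :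
    Lα.Substructure M where
  carrier := A
  fun_mem {n} f x hx := by
    have := (realize_closureSentence_iff ι A f).1 (h n f) x hx
    rwa [LHom.map_onFunction] at this

variable [Lα.Structure M] [ι.IsExpansionOn M] (𝒜 : Lα.Substructure M)

theorem toPair_isExpansionOn (A : Set M) :
    letI := pairStructure Lβ A
    (toPair (Lβ := Lβ) ι).IsExpansionOn M :=
  letI := pairStructure Lβ A
  ⟨fun f x => (LHom.map_onFunction ι f x : _), fun R x => (LHom.map_onRelation ι R x : _)⟩

theorem realize_relativize {α : Type u} {n : ℕ} (θ : Lα.BoundedFormula α n) (v : α → 𝒜)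
    (xs : Fin n → 𝒜) :
    letI := pairStructure Lβ (𝒜 : Set M)
    (relativize (Lβ := Lβ) ι θ).Realize (fun a => (v a : M)) (fun i => (xs i : M)) ↔
      θ.Realize v xs := by
  let _ := pairStructure Lβ (𝒜 : Set M)
  have := toPair_isExpansionOn (Lβ := Lβ) ι (𝒜 : Set M)
  have key : ∀ {m : ℕ} (xs : Fin m → 𝒜) (t : Lα.Term (α ⊕ Fin m)),
      ((toPair (Lβ := Lβ) ι).onTerm t).realize
        (Sum.elim (fun a => (v a : M)) (fun i => (xs i : M))) =
        (t.realize (Sum.elim v xs) : 𝒜) := by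
    intro m xs t
    rw [LHom.realize_onTerm]
    refine Eq.trans ?_ (HomClass.realize_term 𝒜.subtype (t := t) (v := Sum.elim v xs))
    congr 1
    ext (a | i) <;> rfl
  induction θ with
  | falsum => exact Iff.rfl
  | equal t₁ t₂ =>
    refine (BoundedFormula.realize_bdEqual _ _).trans ?_
    rw [key, key]
    exact Subtype.ext_iff.symm
  | rel R ts =>
    refine BoundedFormula.realize_rel.trans ?_
    rw [LHom.map_onRelation]
    simp only [key]
    exact Iff.rfl
  | imp _ _ ih₁ ih₂ => exact imp_congr (ih₁ xs) (ih₂ xs)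
  | all θ ih =>
    refine BoundedFormula.realize_all.trans ?_
    rw [BoundedFormula.realize_all]
    constructor
    · intro h a
      refine (ih (Fin.snoc xs a)).1 ?_
      have := h a ?_
      · convert this using 1
        ext i
        refine Fin.lastCases ?_ (fun i => ?_) i <;> simp
      · refine BoundedFormula.realize_rel₁.2 ?_
        simp only [Term.realize_var, Sum.elim_inr, Fin.snoc_last]
        exact a.2
    · intro h a ha
      have ha : a ∈ 𝒜 := by
        have := BoundedFormula.realize_rel₁.1 ha
        simp only [Term.realize_var, Sum.elim_inr, Fin.snoc_last] at this
        exact this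
      have := (ih (Fin.snoc xs ⟨a, ha⟩)).2 (h ⟨a, ha⟩)
      convert this using 1
      ext i
      refine Fin.lastCases ?_ (fun i => ?_) i <;> simp

theorem pairRealize_relativize {α : Type u} (θ : Lα.Formula α) (v : α → 𝒜) :
    PairRealize (𝒜 : Set M) (relativize (Lβ := Lβ) ι θ) (fun a => (v a : M)) ↔ θ.Realize v := by
  have := realize_relativize (Lβ := Lβ) ι 𝒜 θ v default
  rw [Formula.Realize, ← this]
  refine iff_of_eq ?_
  unfold PairRealize Formula.Realize
  congr 1
  exact Subsingleton.elim _ _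

theorem pairModels_T2 {Tα : Lα.Theory} {Tβ : Lβ.Theory} [Nonempty 𝒜] (hβ : M ⊨ Tβ)
    (hα : 𝒜 ⊨ Tα) : PairModels (T2 ι Tα Tβ) M (𝒜 : Set M) := by
  let _ := pairStructure Lβ (𝒜 : Set M)
  refine Theory.model_union_iff.2 ⟨Theory.model_union_iff.2
    ⟨(pairModels_onTheory _ _).2 hβ, ⟨?_⟩⟩, ⟨?_⟩⟩
  · rintro _ ⟨φ, hφ, rfl⟩
    have := (pairRealize_relativize (Lβ := Lβ) ι 𝒜 φ default).2 (hφ.realize_sentence 𝒜)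
    exact Eq.mp (congrArg (PairRealize (𝒜 : Set M) _) (Subsingleton.elim _ _)) this
  · rintro _ ⟨n, f, rfl⟩
    refine (realize_closureSentence_iff ι (𝒜 : Set M) f).2 fun x hx => ?_
    rw [LHom.map_onFunction]
    exact 𝒜.fun_mem f x hx

end

end PairSemantics

/-! ### Models of `T^d_K` -/

section TdKModels

variable {K : Subfield ℝ}

theorem realize_tLinComb {M : Type w} [(ovsLang K).Structure M] [AddCommGroup M] [Module K M]
    [LinearOrder M] [IsOVS K M] {α : Type} {n : ℕ} (k : Fin n → K) (x : Fin n → α) (v : α → M) :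
    (tLinComb k x).realize v = ∑ i, k i • v (x i) := by
  have key : ∀ l : List ((ovsLang K).Term α), (l.foldr tAdd tZero).realize v =
      (l.map fun t => t.realize v).sum := by
    intro l
    induction l with
    | nil => exact realize_zeroTerm v
    | cons t l ih =>
      rw [List.foldr_cons, List.map_cons, List.sum_cons, ← ih]
      exact realize_addTerm v _ _
  rw [tLinComb, key, List.map_ofFn, List.sum_ofFn]
  exact Finset.sum_congr rfl fun i _ => realize_smulTerm v (k i) _

variable {M : Type w} [(ovsLang K).Structure M] {A : Set M}

theorem PairModels.realize_mem {Lβ : FirstOrder.Language.{0, 0}} {M : Type w} [Lβ.Structure M]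
    {A : Set M} {T : (pairLang Lβ).Theory} (h : PairModels T M A) {θ : (pairLang Lβ).Sentence}
    (hθ : θ ∈ T) : PairRealize A θ default :=
  let _ := pairStructure Lβ A
  Theory.model_iff _ |>.1 h θ hθ

theorem PairModels.models_ovsTheory (h : PairModels (TdK K) M A) : M ⊨ ovsTheory K := by
  refine (pairModels_onTheory A _).1 ?_
  let _ := pairStructure (ovsLang K) A
  exact (Theory.model_iff _).2 fun θ hθ => h.realize_mem (.inl (.inl (.inl (.inl hθ))))

theorem PairModels.realize_closureSentence (h : PairModels (TdK K) M A) (n : ℕ)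
    (f : (ovsLang ℚ).Functions n) : PairRealize A (closureSentence (ovsIncl K) f) default :=
  h.realize_mem (.inl (.inl (.inl (.inr ⟨n, f, rfl⟩))))

theorem pairRealize_fAllA {α : Type} {n : ℕ} (x : Fin n → α) (v : α → M) :
    PairRealize A (fAllA K x) v ↔ ∀ i, v (x i) ∈ A := by
  let _ := pairStructure (ovsLang K) A
  refine Formula.realize_iInf.trans (forall_congr' fun i => ?_)
  exact pairRealize_formula₁_predA A _ _

variable [AddCommGroup M] [Module K M] [LinearOrder M] [IsOVS K M]

theorem PairModels.exists_mem_between (h : PairModels (TdK K) M A) {x y : M} (hxy : x < y) :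
    ∃ z ∈ A, x < z ∧ z < y := by
  have h := h.realize_mem (θ := densitySentence K) (.inl (.inl (.inr rfl)))
  let _ := pairStructure (ovsLang K) A
  have := sumInl_isExpansionOn_pairStructure (Lβ := ovsLang K) A
  have h := BoundedFormula.realize_all.1 (BoundedFormula.realize_all.1 h x) y
  rw [BoundedFormula.realize_imp, LHom.realize_onBoundedFormula, realize_fLt,
    IsOVS.ovsLt_iff] at h
  obtain ⟨z, hz⟩ := BoundedFormula.realize_ex.1 (h hxy)
  rw [BoundedFormula.realize_inf, BoundedFormula.realize_inf, LHom.realize_onBoundedFormula,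
    LHom.realize_onBoundedFormula, realize_fLt, realize_fLt,
    IsOVS.ovsLt_iff, IsOVS.ovsLt_iff] at hz
  exact ⟨z, BoundedFormula.realize_rel₁.1 hz.1, hz.2.1, hz.2.2⟩

theorem PairModels.exists_ne_sum (h : PairModels (TdK K) M A) {n : ℕ} {k : Fin n → K}
    (hk : LinearIndependent ℚ k) :
    ∃ r : M, ∀ x : Fin n → M, (∀ i, x i ∈ A) → r ≠ ∑ i, k i • x i := by
  have h := h.realize_mem (θ := notCoveredSentence K k) (.inl (.inr ⟨n, k, hk, rfl⟩))
  let _ := pairStructure (ovsLang K) A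
  have := sumInl_isExpansionOn_pairStructure (Lβ := ovsLang K) A
  obtain ⟨r, hr⟩ := Formula.realize_iExs.1 h
  refine ⟨r (), fun x hx => ?_⟩
  have h := Formula.realize_iAlls.1 hr x
  rw [Formula.realize_imp, Formula.realize_not, Formula.realize_equal, LHom.realize_onTerm,
    realize_tLinComb] at h
  exact h ((pairRealize_fAllA _ _).2 hx)

theorem PairModels.eq_zero_of_sum_eq_zero (h : PairModels (TdK K) M A) {n : ℕ} {k : Fin n → K}
    (hk : LinearIndependent ℚ k) {x : Fin n → M} (hx : ∀ i, x i ∈ A)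
    (h0 : ∑ i, k i • x i = 0) (i : Fin n) : x i = 0 := by
  have h := h.realize_mem (θ := independentSentence K k) (.inr ⟨n, k, hk, rfl⟩)
  let _ := pairStructure (ovsLang K) A
  have := sumInl_isExpansionOn_pairStructure (Lβ := ovsLang K) A
  have h := Formula.realize_iAlls.1 h x
  have hz : ∀ v : Empty ⊕ Fin n → M, (tZero (F := K)).realize v = 0 := realize_zeroTerm
  rw [Formula.realize_imp, Formula.realize_imp, Formula.realize_equal, LHom.realize_onTerm,
    realize_tLinComb, LHom.realize_onTerm, hz, Formula.realize_iInf] at h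
  have h := h ((pairRealize_fAllA _ _).2 hx) h0 i
  rwa [Formula.realize_equal, LHom.realize_onTerm, hz] at h

end TdKModels

/-! ### Rational reducts and their substructures -/

section Reduct

variable {K : Subfield ℝ} {M : Type w} [(ovsLang K).Structure M] [(ovsLang ℚ).Structure M]
  [(ovsIncl K).IsExpansionOn M]

theorem IsOVS.rat [AddCommGroup M] [Module K M] [Module ℚ M] [LinearOrder M] [IsOVS K M] :
    IsOVS ℚ M where
  ovsZero_eq := by
    rw [← IsOVS.ovsZero_eq (F := K)]
    exact (LHom.map_onFunction (ovsIncl K) (zeroSymb (F := ℚ)) _).symm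
  ovsAdd_eq a b := by
    rw [← IsOVS.ovsAdd_eq (F := K)]
    exact (LHom.map_onFunction (ovsIncl K) (addSymb (F := ℚ)) _).symm
  ovsSmul_eq q a := by
    rw [← Rat.cast_smul_eq_qsmul K, ← IsOVS.ovsSmul_eq]
    exact (LHom.map_onFunction (ovsIncl K) (smulSymb q) _).symm
  ovsLt_iff a b := by
    rw [← IsOVS.ovsLt_iff (F := K)]
    exact Iff.of_eq (LHom.map_onRelation (ovsIncl K) (ltSymb (F := ℚ)) _).symm
  smul_pos q a hq ha := by
    rw [← Rat.cast_smul_eq_qsmul K]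
    exact IsOVS.smul_pos _ _ (by exact_mod_cast hq) ha
  one_pos := by
    convert IsOVS.one_pos (F := K) (M := M) using 1
    exact (LHom.map_onFunction (ovsIncl K) (oneSymb (F := ℚ)) _).symm

theorem ovsOne_rat : ovsOne ℚ M = ovsOne K M :=
  (LHom.map_onFunction (ovsIncl K) (oneSymb (F := ℚ)) _).symm

theorem models_ovsTheory_rat (h : M ⊨ ovsTheory K) : M ⊨ ovsTheory ℚ := by
  obtain ⟨_, _, _, _⟩ := exists_isOVS h
  let _ : Module ℚ M := Module.compHom M (algebraMap ℚ K)
  have : IsOVS ℚ M := IsOVS.rat (K := K)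
  exact IsOVS.models

instance (𝒜 : (ovsLang ℚ).Substructure M) : Nonempty 𝒜 :=
  ⟨⟨_, 𝒜.constants_mem zeroSymb⟩⟩

theorem pairModels_T2_ovsTheory (h : M ⊨ ovsTheory K) (𝒜 : (ovsLang ℚ).Substructure M) :
    PairModels (T2 (ovsIncl K) (ovsTheory ℚ) (ovsTheory K)) M (𝒜 : Set M) :=
  have := models_ovsTheory_rat h
  pairModels_T2 _ 𝒜 h inferInstance

end Reduct

/-! ### Consistency, and the inclusion of `T²` in `T^d_K` -/

section Consistency

variable (K : Subfield ℝ)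

theorem ovsIncl_injective : (ovsIncl K).Injective where
  onFunction {n} f g h := by
    cases f <;> cases g <;> first | rfl | cases h | skip
    rename_i p q
    injection h with h
    have : p = q := Rat.cast_injective (α := K) h
    rw [this]
  onRelation {n} f g h := h

theorem isSatisfiable_ovsTheory (F : Type) [Field F] [LinearOrder F] [IsStrictOrderedRing F] :
    (ovsTheory F).IsSatisfiable := by
  let _ := fieldOVSStructure F
  have := models_fieldOVSStructure F
  exact Theory.Model.isSatisfiable F

/-- `T²` does not ask `A` to be a proper subset, so `K` with `A` interpreted as all of `K` is a
model. -/
theorem isSatisfiable_T2 : (T2 (ovsIncl K) (ovsTheory ℚ) (ovsTheory K)).IsSatisfiable := by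
  let _ := fieldOVSStructure K
  let _ := (ovsIncl K).reduct K
  have h := pairModels_T2_ovsTheory (models_fieldOVSStructure K) ⊤
  let _ := pairStructure (ovsLang K) ((⊤ : (ovsLang ℚ).Substructure K) : Set K)
  exact @Theory.Model.isSatisfiable _ _ K _ _ h

theorem TdK_models_T2 : ∀ θ ∈ T2 (ovsIncl K) (ovsTheory ℚ) (ovsTheory K), TdK K ⊨ᵇ θ := by
  intro θ hθ
  rw [Theory.models_sentence_iff]
  intro M
  obtain ⟨M⟩ := M
  rename_i S hM _
  obtain ⟨_, A, rfl⟩ := exists_eq_pairStructure S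
  have hM : PairModels (TdK K) M A := hM
  let _ := (ovsIncl K).reduct M
  let 𝒜 := pairSubstructure (ovsIncl K) A hM.realize_closureSentence
  exact (pairModels_T2_ovsTheory hM.models_ovsTheory 𝒜).realize_mem hθ

end Consistency

/-! ### The Mordell-Lang condition -/

section MordellLang

/-- Choose `S ⊆ R` minimal with `a ∈ acl (S ∪ B)`. Minimality makes `S` independent over `B`, hence
over `A ∪ B`. For `s ∈ S`, exchange would make `s` algebraic over `a`, `S \ {s}` and `B`, against
this independence because `a ∈ A`. So `S` is empty. -/
theorem mem_acl_of_indep {L : FirstOrder.Language.{0, 0}} {M : Type w} [L.Structure M]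
    (hL : IsPregeometry (acl L : Set M → Set M)) {R A B : Set M} (hR : R.Finite)
    (h : Indep L R A B) {a : M} (haA : a ∈ A) (ha : a ∈ acl L (R ∪ B)) : a ∈ acl L B := by
  obtain ⟨S, ⟨hSR, haS⟩, hmin⟩ := (hR.finite_subsets.subset
    (Set.sep_subset {S | S ⊆ R} fun S => a ∈ acl L (S ∪ B))).exists_minimal ⟨R, Set.Subset.refl R, ha⟩
  have hmin : ∀ s ∈ S, a ∉ acl L (S \ {s} ∪ B) := fun s hs ha =>
    (hmin ⟨Set.sdiff_subset.trans hSR, ha⟩ Set.sdiff_subset hs).2 rfl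
  have hunion : ∀ s ∈ S, S ∪ B = insert s (S \ {s} ∪ B) := fun s hs => by
    rw [← Set.insert_union, Set.insert_sdiff_singleton, Set.insert_eq_of_mem hs]
  have hind : AclIndepOver L S B := by
    intro s hs hs'
    refine hmin s hs ?_
    rw [← hL.idem]
    refine hL.mono _ _ ?_ haS
    rw [hunion s hs]
    exact Set.insert_subset hs' (hL.subset_cl _)
  rcases S.eq_empty_or_nonempty with rfl | ⟨s, hs⟩
  · simpa using haS
  · rw [hunion s hs] at haS
    refine (h S hSR hind s hs (hL.mono _ _ ?_ (hL.exchange _ _ _ haS (hmin s hs)))).elim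
    refine Set.insert_subset (.inr (.inl haA)) (Set.union_subset_union_right _ ?_)
    exact Set.subset_union_right

theorem RealizesType.realize_iff {L : FirstOrder.Language.{0, 0}} {T : L.Theory} {α : Type}
    {p : T.CompleteType α} {M N : Type w} [L.Structure M] [L.Structure N] {v : α → M} {v' : α → N}
    (h : RealizesType p v) (h' : RealizesType p v') (θ : L.Formula α) :
    θ.Realize v ↔ θ.Realize v' := by
  rcases p.mem_or_not_mem (Formula.equivSentence θ) with hp | hp
  · exact iff_of_true (h θ hp) (h' θ hp)
  · rw [← Formula.equivSentence_not] at hp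
    exact iff_of_false (Formula.realize_not.1 (h _ hp)) (Formula.realize_not.1 (h' _ hp))

theorem realize_subst_unit {L : FirstOrder.Language.{0, 0}} {β : Type} {M : Type w}
    [L.Structure M] (φ : L.Formula (β ⊕ Unit)) (t : L.Term β) (v : β → M) :
    Formula.Realize (BoundedFormula.subst φ (Sum.elim Term.var fun _ => t)) v ↔
      φ.Realize (Sum.elim v fun _ => t.realize v) := by
  refine BoundedFormula.realize_subst.trans (iff_of_eq ?_)
  unfold Formula.Realize
  congr 1
  ext (a | a) <;> rfl

theorem exists_submodule_eq {M : Type w} [(ovsLang ℚ).Structure M] [AddCommGroup M] [Module ℚ M]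
    [LinearOrder M] [IsOVS ℚ M] (𝒜 : (ovsLang ℚ).Substructure M) :
    ∃ P : Submodule ℚ M, (P : Set M) = 𝒜 ∧ ovsOne ℚ M ∈ P :=
  ⟨{  carrier := 𝒜
      add_mem' := fun {a b} ha hb => by
        rw [← IsOVS.ovsAdd_eq (F := ℚ)]
        refine 𝒜.fun_mem addSymb _ fun i => ?_
        fin_cases i
        exacts [ha, hb]
      zero_mem' := by
        rw [← IsOVS.ovsZero_eq (F := ℚ)]
        exact 𝒜.constants_mem zeroSymb
      smul_mem' := fun q a ha => by
        rw [← IsOVS.ovsSmul_eq]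
        refine 𝒜.fun_mem (smulSymb q) _ fun i => ?_
        fin_cases i
        exact ha }, rfl, 𝒜.constants_mem oneSymb⟩

variable {K : Subfield ℝ}

theorem basis_expansion {M : Type w} [AddCommGroup M] [Module K M] [Module ℚ M]
    {W : Submodule ℚ K} {n : ℕ} (b : Module.Basis (Fin n) ℚ W) (k : W) (x : M) :
    (k : K) • x = ∑ j, (b j : K) • (b.repr k j • x) := by
  conv_lhs => rw [← b.sum_repr k]
  rw [AddSubmonoidClass.coe_finsetSum, Finset.sum_smul]
  refine Finset.sum_congr rfl fun j _ => ?_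
  rw [Submodule.coe_smul, ← Rat.cast_smul_eq_qsmul K (b.repr k j) x, smul_smul, Rat.smul_def,
    mul_comm]

/-- Linear combinations over `K` of elements of `Q` that lie in `Q` are linear combinations
over `ℚ`. -/
theorem mem_span_rat_of_mem_span {M : Type w} [AddCommGroup M] [Module K M] [Module ℚ M]
    {Q : Submodule ℚ M} (hQ : ∀ {n : ℕ} {k : Fin n → K}, LinearIndependent ℚ k →
      ∀ {x : Fin n → M}, (∀ i, x i ∈ Q) → ∑ i, k i • x i = 0 → ∀ i, x i = 0)
    {X : Set M} (hX : X ⊆ Q) {a : M} (haQ : a ∈ Q) (ha : a ∈ Submodule.span K X) :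
    a ∈ Submodule.span ℚ X := by
  obtain ⟨n, f, g, rfl⟩ := Submodule.mem_span_set'.1 ha
  set a := ∑ i, f i • (g i : M) with ha_def
  -- The scalar `1` is included so that `a = 1 • a` expands in the same basis as the terms `f i • g
  -- i`.
  let W : Submodule ℚ K := Submodule.span ℚ (Set.range (Fin.cons 1 f : Fin (n + 1) → K))
  have : FiniteDimensional ℚ W := FiniteDimensional.span_of_finite ℚ (Set.finite_range _)
  have hf : ∀ i, f i ∈ W := fun i => Submodule.subset_span ⟨i.succ, by simp⟩
  have h1 : (1 : K) ∈ W := Submodule.subset_span ⟨0, by simp⟩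
  let b := Module.finBasis ℚ W
  have hb : LinearIndependent ℚ fun j => (b j : K) :=
    b.linearIndependent.map' W.subtype (Submodule.ker_subtype W)
  have hrepr := basis_expansion (M := M) b
  -- The relation `∑ f i • g i - 1 • a = 0`, collected along the basis `b`, has coefficients in `Q`,
  -- so each of them vanishes.
  have key := hQ hb (x := fun j => ∑ i, b.repr ⟨f i, hf i⟩ j • (g i : M) - b.repr ⟨1, h1⟩ j • a)
    (fun j => Q.sub_mem (Q.sum_mem fun i _ => Q.smul_mem _ (hX (g i).2)) (Q.smul_mem _ haQ)) (by
      simp only [smul_sub, Finset.sum_sub_distrib, ← hrepr ⟨1, h1⟩ a, Finset.smul_sum]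
      rw [Finset.sum_comm]
      simp only [← hrepr ⟨f _, hf _⟩, one_smul, ha_def, sub_self])
  -- At a nonzero coordinate of `1`, the vanishing coefficient can be solved rationally for `a`.
  obtain ⟨j, hj⟩ : ∃ j, b.repr ⟨1, h1⟩ j ≠ 0 := by
    by_contra! h
    have : (⟨1, h1⟩ : W) = 0 := b.repr.map_eq_zero_iff.1 (Finsupp.ext h)
    exact one_ne_zero (congrArg Subtype.val this)
  have ha' : b.repr ⟨1, h1⟩ j • a ∈ Submodule.span ℚ X := by
    rw [← sub_eq_zero.1 (key j)]
    exact Submodule.sum_mem _ fun i _ => Submodule.smul_mem _ _ (Submodule.subset_span (g i).2)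
  exact (Submodule.smul_mem_iff _ hj).1 ha'

/-- In a solution, the element `a` is given by a term in the components of `c` that lie in `A`. -/
theorem IsSolution.exists_term_eq {χ : Challenge.{w} (ovsTheory ℚ) (ovsTheory K)} {M : Type w}
    [Nonempty M] [(ovsLang K).Structure M] [(ovsLang ℚ).Structure M] [(ovsIncl K).IsExpansionOn M]
    {A : Set M} {c : Fin χ.n → M} {a : M} (h : IsSolution (ovsIncl K) (TdK K) χ M A c a) :
    ∃ t : (ovsLang ℚ).Term χ.s, t.realize (fun i : χ.s => c i) = a := by
  have hM := h.contender.models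
  have hβ := hM.models_ovsTheory
  have hgeo := isGeometric_ovsTheory.2 M hβ
  have hfin := χ.finite M hβ c h.contender.realizes_q
  obtain ⟨_, _, _, _⟩ := exists_isOVS hβ
  let _ : Module ℚ M := Module.compHom M (algebraMap ℚ K)
  have : IsOVS ℚ M := IsOVS.rat (K := K)
  let 𝒜 := pairSubstructure (ovsIncl K) A hM.realize_closureSentence
  obtain ⟨Q, hQ, hone⟩ := exists_submodule_eq 𝒜
  have hQA : (Q : Set M) = A := hQ
  have ha : a ∈ acl (ovsLang K) (Set.range c) := by
    obtain ⟨t, ht⟩ := exists_term_of_finite hfin h.realizes_φ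
    rw [acl_eq_span, SetLike.mem_coe, mem_span_iff_exists_term]
    exact ⟨t, ht⟩
  have ha' := mem_acl_of_indep hgeo (Set.finite_range c) h.contender.indep h.mem
    (hgeo.mono _ _ Set.subset_union_left ha)
  rw [acl_eq_span, SetLike.mem_coe, ← ovsOne_rat] at ha'
  have hs : c '' χ.s = Set.range fun i : χ.s => c i := Set.image_eq_range _ _
  rw [← mem_span_iff_exists_term (F := ℚ), ← hs]
  refine mem_span_rat_of_mem_span (Q := Q) ?_ ?_ ?_ ha'
  · intro n k hk x hx
    exact hM.eq_zero_of_sum_eq_zero hk fun i => hQA ▸ hx i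
  · rw [hQA]
    refine Set.insert_subset (hQA ▸ hone) ?_
    rintro _ ⟨i, hi, rfl⟩
    exact (h.contender.mem_iff i).2 hi
  · rw [← SetLike.mem_coe, hQA]
    exact h.mem

theorem mordellLangCondition_TdK :
    MordellLangCondition.{w} (ovsIncl K) (ovsTheory ℚ) (ovsTheory K) (TdK K) := by
  rintro χ ⟨N, _, _, A', c', a', hN⟩ M _ _ A c hM
  let _ := (ovsIncl K).reduct N
  let _ := (ovsIncl K).reduct M
  obtain ⟨t, rfl⟩ := hN.exists_term_eq
  let 𝒜' := pairSubstructure (ovsIncl K) A' hN.contender.models.realize_closureSentence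
  let 𝒜 := pairSubstructure (ovsIncl K) A hM.models.realize_closureSentence
  let d' : χ.s → 𝒜' := fun i => ⟨c' i, (hN.contender.mem_iff i).2 i.2⟩
  let d : χ.s → 𝒜 := fun i => ⟨c i, (hM.mem_iff i).2 i.2⟩
  have hd' : RealizesType χ.p d' := fun θ hθ =>
    (pairRealize_relativize _ 𝒜' θ d').1 (hN.contender.realizes_p θ hθ)
  have hd : RealizesType χ.p d := fun θ hθ =>
    (pairRealize_relativize _ 𝒜 θ d).1 (hM.realizes_p θ hθ)
  have hmem : ∀ {M : Type w} [(ovsLang ℚ).Structure M] (𝒜 : (ovsLang ℚ).Substructure M)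
      (d : χ.s → 𝒜), ((t.realize d : 𝒜) : M) = t.realize fun i => (d i : M) := fun 𝒜 d =>
    (HomClass.realize_term 𝒜.subtype (t := t) (v := d)).symm
  refine ⟨t.realize fun i : χ.s => c i, hM, ?_, ?_, ?_⟩
  · rw [← hmem 𝒜 d]
    exact (t.realize d).2
  · have key : ∀ {M : Type w} [(ovsLang K).Structure M] [(ovsLang ℚ).Structure M]
        [(ovsIncl K).IsExpansionOn M] (c : Fin χ.n → M),
        (((ovsIncl K).onTerm t).relabel Subtype.val).realize c = t.realize fun i : χ.s => c i := by
      intro M _ _ _ c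
      rw [Term.realize_relabel, LHom.realize_onTerm]
      rfl
    have := hN.realizes_φ
    -- After substituting `t` for `y`, the condition on `a` is a formula in `x` alone, which the
    -- complete type `q` decides; `p` does the same for `ψ` below.
    rw [← key, ← realize_subst_unit] at this
    rw [← key, ← realize_subst_unit]
    exact (hN.contender.realizes_q.realize_iff hM.realizes_q _).1 this
  · have key : ∀ {M : Type w} [(ovsLang K).Structure M] [(ovsLang ℚ).Structure M]
        [(ovsIncl K).IsExpansionOn M] (𝒜 : (ovsLang ℚ).Substructure M) (d : χ.s → 𝒜),
        PairRealize (𝒜 : Set M) (relativize (ovsIncl K) χ.ψ)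
          (Sum.elim (fun i => (d i : M)) fun _ => t.realize fun i => (d i : M)) ↔
        Formula.Realize (BoundedFormula.subst χ.ψ (Sum.elim Term.var fun _ => t)) d := by
      intro M _ _ _ 𝒜 d
      rw [realize_subst_unit, ← pairRealize_relativize (Lβ := ovsLang K) (ovsIncl K), ← hmem]
      refine iff_of_eq (congrArg _ ?_)
      ext (i | i) <;> rfl
    exact (key 𝒜 d).2 ((hd'.realize_iff hd _).1 ((key 𝒜' d').1 hN.realizes_ψ))

end MordellLang

/-! ### Density and codensity -/

section Types

variable {L : FirstOrder.Language.{0, 0}} {M : Type w} [L.Structure M] {C : Set M}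
  {q : Set (FormulaOver L C)}

theorem IsTypeOver.mem_of_forall (hq : IsTypeOver q) {Δ : Finset (FormulaOver L C)}
    (hΔ : ↑Δ ⊆ q) {χ : FormulaOver L C} (h : ∀ b : M, (∀ φ ∈ Δ, SatOver φ b) → SatOver χ b) :
    χ ∈ q := by
  classical
  refine (hq.complete χ).resolve_right fun hχ => ?_
  obtain ⟨b, hb⟩ := hq.finSat (insert χ.not Δ) (by
    rw [Finset.coe_insert]
    exact Set.insert_subset hχ hΔ)
  exact Formula.realize_not.1 (hb _ (Finset.mem_insert_self _ _))
    (h b fun φ hφ => hb φ (Finset.mem_insert_of_mem hφ))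

theorem IsTypeOver.top_mem (hq : IsTypeOver q) : ⊤ ∈ q :=
  hq.mem_of_forall (Δ := ∅) (by simp) fun b _ => Formula.realize_top.2 trivial

theorem IsTypeOver.inf_mem (hq : IsTypeOver q) {φ ψ : FormulaOver L C} (hφ : φ ∈ q)
    (hψ : ψ ∈ q) : φ ⊓ ψ ∈ q := by
  classical
  refine hq.mem_of_forall (Δ := {φ, ψ}) ?_ fun b hb => Formula.realize_inf.2
    ⟨hb φ (by simp), hb ψ (by simp)⟩
  rw [Finset.coe_pair]
  exact Set.insert_subset hφ (Set.singleton_subset_iff.2 hψ)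

end Types

variable {K : Subfield ℝ} {M : Type w} [(ovsLang K).Structure M]

theorem satOver_onFormula {A C : Set M} (φ : FormulaOver (ovsLang K) C) (b : M) :
    (letI := pairStructure (ovsLang K) A
     SatOver (C := C) (LHom.sumInl.onFormula φ : (pairLang (ovsLang K)).Formula (C ⊕ Unit)) b) ↔
      SatOver φ b :=
  pairRealize_onFormula A φ _

theorem exists_interval_of_mem [AddCommGroup M] [Module K M] [LinearOrder M] [IsOVS K M]
    {C : Set M} {q : Set (FormulaOver (ovsLang K) C)} (hna : NonAlgebraic q)
    {χ : FormulaOver (ovsLang K) C} (hχ : χ ∈ q) :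
    ∃ x y, x < y ∧ ∀ z, x < z → z < y → SatOver χ z :=
  (infinite_iff_exists_interval χ _).1 (hna χ hχ)

/-- In `𝒜` the formula `θ` is equivalent to a quantifier-free one, which also lies in `p` and whose
truth is the same in `𝒜` and in `M`. Its transfer to `q` thus forces `θ` relativized to `A` on all
elements of `A`. -/
theorem exists_mem_transfer [(ovsLang ℚ).Structure M] [(ovsIncl K).IsExpansionOn M]
    {𝒜 : (ovsLang ℚ).Substructure M} (h𝒜 : 𝒜 ⊨ ovsTheory ℚ) {C : Set M}
    {q : Set (FormulaOver (ovsLang K) C)}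
    {p : Set (FormulaOver (ovsLang ℚ) {a : 𝒜 | (a : M) ∈ C})} (hp : IsTypeOver p)
    (hpq : ∀ θ ∈ p, BoundedFormula.IsQF θ → transfer (ovsIncl K) θ ∈ q)
    {θ : FormulaOver (ovsLang ℚ) {a : 𝒜 | (a : M) ∈ C}} (hθ : θ ∈ p) :
    ∃ χ ∈ q, ∀ a ∈ 𝒜, SatOver χ a → PairRealize (𝒜 : Set M) (relativize (ovsIncl K) θ)
      (Sum.elim (fun c => ((c : 𝒜) : M)) fun _ => a) := by
  obtain ⟨_, _, _, _⟩ := exists_isOVS h𝒜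
  obtain ⟨θ', hθ', h⟩ := exists_isQF.{w} θ
  have hmem : θ' ∈ p := hp.mem_of_forall (Δ := {θ}) (by simpa using hθ) fun b hb =>
    (h 𝒜 _ _).1 (hb θ (by simp))
  refine ⟨_, hpq θ' hmem hθ', fun a ha hχ => ?_⟩
  let v : {a : 𝒜 | (a : M) ∈ C} ⊕ Unit → 𝒜 := Sum.elim Subtype.val fun _ => ⟨a, ha⟩
  have hv : (fun i => (v i : M)) =
      Sum.elim (fun c : {a : 𝒜 | (a : M) ∈ C} => ((c : 𝒜) : M)) fun _ => a := by
    ext (i | i) <;> rfl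
  rw [← hv]
  refine (pairRealize_relativize _ 𝒜 θ v).2 ((h 𝒜 v default).2 ?_)
  rw [SatOver, transfer, Formula.realize_relabel, LHom.realize_onFormula] at hχ
  refine (hθ'.realize_embedding 𝒜.subtype).1 ?_
  rw [Formula.Realize] at hχ
  convert hχ using 1
  · ext (i | i) <;> rfl

theorem densityCondition_TdK : DensityCondition.{w} (ovsIncl K) (TdK K) := by
  classical
  intro M _ _ _ _ 𝒜 κ hM _ hsat C hC q hq hna p hp hpq
  have hβ := hM.models_ovsTheory
  have := models_ovsTheory_rat hβ
  have h𝒜 : 𝒜 ⊨ ovsTheory ℚ := inferInstance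
  obtain ⟨_, _, _, _⟩ := exists_isOVS hβ
  let _ := pairStructure (ovsLang K) (𝒜 : Set M)
  let g : {a : 𝒜 | (a : M) ∈ C} ⊕ Unit → C ⊕ Unit :=
    Sum.map (fun a => (⟨((a : 𝒜) : M), a.2⟩ : C)) id
  let rel (θ : FormulaOver (ovsLang ℚ) {a : 𝒜 | (a : M) ∈ C}) :
      FormulaOver (pairLang (ovsLang K)) C :=
    Formula.relabel g (relativize (ovsIncl K) θ)
  have hrel : ∀ θ b, SatOver (rel θ) b ↔ PairRealize (𝒜 : Set M) (relativize (ovsIncl K) θ)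
      (Sum.elim (fun c => ((c : 𝒜) : M)) fun _ => b) := by
    intro θ b
    refine Formula.realize_relabel.trans (iff_of_eq (congrArg _ ?_))
    ext (i | i) <;> rfl
  let predX : FormulaOver (pairLang (ovsLang K)) C :=
    (predA (ovsLang K)).formula₁ (Term.var (.inr ()))
  have hpredX : ∀ b : M, SatOver predX b ↔ b ∈ 𝒜 := fun b =>
    pairRealize_formula₁_predA (𝒜 : Set M) _ _
  let Γ : Set (FormulaOver (pairLang (ovsLang K)) C) :=
    insert predX ((fun φ => LHom.sumInl.onFormula φ) '' q ∪ rel '' p)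
  -- On elements of `A` each requirement follows from one formula of `q`, so a finite part of `Γ`
  -- reduces to a conjunction in `q`. That conjunction holds on an interval, which meets `A`.
  have hΓ : ∀ γ ∈ Γ, ∃ χ ∈ q, ∀ a ∈ 𝒜, SatOver χ a → SatOver γ a := by
    rintro _ (rfl | ⟨φ, hφ, rfl⟩ | ⟨θ, hθ, rfl⟩)
    · exact ⟨⊤, hq.top_mem, fun a ha _ => (hpredX a).2 ha⟩
    · exact ⟨φ, hφ, fun a _ h => (satOver_onFormula φ a).2 h⟩
    · obtain ⟨χ, hχ, h⟩ := exists_mem_transfer h𝒜 hp hpq hθ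
      exact ⟨χ, hχ, fun a ha hχa => (hrel θ a).2 (h a ha hχa)⟩
  have hfin : FinSat Γ := by
    intro Δ hΔ
    obtain ⟨χ, hχ, h⟩ : ∃ χ ∈ q, ∀ a ∈ 𝒜, SatOver χ a → ∀ γ ∈ Δ, SatOver γ a := by
      induction Δ using Finset.induction_on with
      | empty => exact ⟨⊤, hq.top_mem, by simp⟩
      | insert γ Δ _ ih =>
        rw [Finset.coe_insert, Set.insert_subset_iff] at hΔ
        obtain ⟨χ, hχ, h⟩ := ih hΔ.2
        obtain ⟨χ', hχ', h'⟩ := hΓ γ hΔ.1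
        refine ⟨χ' ⊓ χ, hq.inf_mem hχ' hχ, fun a ha hsat γ hγ => ?_⟩
        have hsat := Formula.realize_inf.1 hsat
        rcases Finset.mem_insert.1 hγ with rfl | hγ
        exacts [h' a ha hsat.1, h a ha hsat.2 γ hγ]
    obtain ⟨x, y, hxy, hI⟩ := exists_interval_of_mem hna hχ
    obtain ⟨a, ha, hxa, hay⟩ := hM.exists_mem_between hxy
    exact ⟨a, h a ha (hI a hxa hay)⟩
  obtain ⟨a, ha⟩ := hsat C hC Γ hfin
  refine ⟨a, (hpredX a).1 (ha _ (.inl rfl)), fun φ hφ => ?_, fun θ hθ => ?_⟩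
  · exact (satOver_onFormula φ a).1 (ha _ (.inr (.inl ⟨φ, hφ, rfl⟩)))
  · exact (hrel θ a).1 (ha _ (.inr (.inr ⟨θ, hθ, rfl⟩)))

/-! ### Cosets of proper dense `ℚ`-subspaces -/

section Codensity

variable {M : Type w} [AddCommGroup M] [Module K M] [Module ℚ M]

/-- The `ℚ`-subspace of `M` generated by the products of elements of `W` and of `Q`. -/
def productSpan (W : Submodule ℚ K) (Q : Set M) :
    Submodule ℚ M :=
  Submodule.span ℚ (Set.image2 (fun (k : K) (x : M) => k • x) W Q)

theorem productSpan_mono {W W' : Submodule ℚ K} (h : W ≤ W') (Q : Set M) :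
    productSpan W Q ≤ productSpan W' Q :=
  Submodule.span_mono (Set.image2_subset_right h)

theorem smul_mem_productSpan {W : Submodule ℚ K} {Q : Set M} {k : K} {x : M} (hk : k ∈ W)
    (hx : x ∈ Q) : k • x ∈ productSpan W Q :=
  Submodule.subset_span ⟨k, hk, x, hx, rfl⟩

/-- Expanding scalars in a `ℚ`-basis `b` of `W` writes every element of `productSpan W Q` as `∑ b i
• x i` with `x i ∈ Q`, and such sums do not exhaust `M`. -/
theorem exists_notMem_productSpan {Q : Submodule ℚ M}
    (hQ : ∀ {n : ℕ} {k : Fin n → K}, LinearIndependent ℚ k →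
      ∃ r : M, ∀ x : Fin n → M, (∀ i, x i ∈ Q) → r ≠ ∑ i, k i • x i)
    (W : Submodule ℚ K) [FiniteDimensional ℚ W] : ∃ r, r ∉ productSpan W (Q : Set M) := by
  let b := Module.finBasis ℚ W
  have hb : LinearIndependent ℚ fun j => (b j : K) :=
    b.linearIndependent.map' W.subtype (Submodule.ker_subtype W)
  obtain ⟨r, hr⟩ := hQ hb
  refine ⟨r, fun hmem => ?_⟩
  suffices ∀ y ∈ productSpan W (Q : Set M), ∃ x : Fin (Module.finrank ℚ W) → M,
      (∀ i, x i ∈ Q) ∧ y = ∑ i, (b i : K) • x i by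
    obtain ⟨x, hx, h⟩ := this r hmem
    exact hr x hx h
  intro y hy
  induction hy using Submodule.span_induction with
  | mem y hy =>
    obtain ⟨k, hk, x, hx, rfl⟩ := hy
    exact ⟨fun j => b.repr ⟨k, hk⟩ j • x, fun j => Q.smul_mem _ hx,
      basis_expansion b ⟨k, hk⟩ x⟩
  | zero => exact ⟨0, fun _ => Q.zero_mem, by simp⟩
  | add y y' _ _ h h' =>
    obtain ⟨x, hx, rfl⟩ := h
    obtain ⟨x', hx', rfl⟩ := h'
    exact ⟨x + x', fun i => Q.add_mem (hx i) (hx' i), by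
      simp [smul_add, Finset.sum_add_distrib]⟩
  | smul c y _ h =>
    obtain ⟨x, hx, rfl⟩ := h
    refine ⟨c • x, fun i => Q.smul_mem _ (hx i), ?_⟩
    rw [Finset.smul_sum]
    refine Finset.sum_congr rfl fun i _ => ?_
    rw [Pi.smul_apply, ← Rat.cast_smul_eq_qsmul K c (x i), ← Rat.cast_smul_eq_qsmul K c,
      smul_comm]

/-- A proper dense subspace does not contain an interval in finitely many of its cosets. -/
theorem exists_mem_interval_forall_sub_notMem [LinearOrder M] [IsOrderedAddMonoid M]
    {A : Set M} (hA : ∀ x y : M, x < y → ∃ z ∈ A, x < z ∧ z < y) {V : Submodule ℚ M}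
    (hAV : A ⊆ V) {r : M} (hr : r ∉ V) {D : Set M} (hD : D.Finite) {x y : M} (hxy : x < y) :
    ∃ b, x < b ∧ b < y ∧ ∀ d ∈ D, b - d ∉ V := by
  -- Since `r ∉ V`, the multiples `n • r` lie in distinct cosets of `V`, so each coset `d + V`
  -- contains at most one of them.
  have hsub : ∀ d, {n : ℕ | n • r - d ∈ V}.Subsingleton := by
    intro d n hn m hm
    by_contra hne
    have h : ((n : ℚ) - m) • r ∈ V := by
      have := V.sub_mem hn hm
      rwa [sub_sub_sub_cancel_right, ← Nat.cast_smul_eq_nsmul ℚ, ← Nat.cast_smul_eq_nsmul ℚ,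
        ← sub_smul] at this
    exact hr ((Submodule.smul_mem_iff _ (sub_ne_zero.2 (by exact_mod_cast hne))).1 h)
  obtain ⟨n, hn⟩ := (hD.biUnion fun d _ => (hsub d).finite).exists_notMem
  -- Choosing `z ∈ A ⊆ V` in the interval shifted by `-n • r` puts `z + n • r` in the original
  -- interval without leaving the coset of `n • r`.
  obtain ⟨z, hz, hxz, hzy⟩ := hA (x - n • r) (y - n • r) (by simpa using hxy)
  refine ⟨z + n • r, sub_lt_iff_lt_add.1 hxz, lt_sub_iff_add_lt.1 hzy, fun d hd h => hn ?_⟩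
  refine Set.mem_biUnion hd ?_
  have := V.sub_mem h (hAV hz)
  rwa [show z + n • r - d - z = n • r - d by abel] at this

end Codensity

/-- The formula `∀ x_1 … x_n, A(x_1) ∧ ⋯ ∧ A(x_n) → y ≠ λ_{k_1}(x_1) + ⋯ + λ_{k_n}(x_n) + t` in the
variable `y`. -/
def avoidFormula {C : Set M} {n : ℕ} (k : Fin n → K) (t : (ovsLang K).Term C) :
    FormulaOver (pairLang (ovsLang K)) C :=
  Formula.iAlls (Fin n) <| ((fAllA K id).relabel Sum.inr).imp
    (Term.equal (Term.var (.inl (.inr ()))) (LHom.sumInl.onTerm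
      (addTerm ((tLinComb k id).relabel .inr) (t.relabel (.inl ∘ .inl))))).not

theorem satOver_avoidFormula [AddCommGroup M] [Module K M] [LinearOrder M] [IsOVS K M]
    {A C : Set M} {n : ℕ} (k : Fin n → K) (t : (ovsLang K).Term C) (b : M) :
    (letI := pairStructure (ovsLang K) A
     SatOver (avoidFormula k t) b) ↔
      ∀ x : Fin n → M, (∀ i, x i ∈ A) → b ≠ ∑ i, k i • x i + t.realize Subtype.val := by
  let _ := pairStructure (ovsLang K) A
  have := sumInl_isExpansionOn_pairStructure (Lβ := ovsLang K) A
  refine Formula.realize_iAlls.trans (forall_congr' fun x => ?_)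
  rw [Formula.realize_imp, Formula.realize_not, Formula.realize_equal, LHom.realize_onTerm,
    realize_addTerm, Formula.realize_relabel, Term.realize_relabel, Term.realize_relabel,
    realize_tLinComb]
  exact imp_congr (pairRealize_fAllA _ _) Iff.rfl

theorem codensityCondition_TdK : CodensityCondition.{w} (TdK K) := by
  classical
  intro M _ _ A κ hM _ hsat C hC q hq hna
  have hβ := hM.models_ovsTheory
  obtain ⟨_, _, _, _⟩ := exists_isOVS hβ
  let _ := (ovsIncl K).reduct M
  let _ : Module ℚ M := Module.compHom M (algebraMap ℚ K)
  have : IsOVS ℚ M := IsOVS.rat (K := K)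
  let 𝒜 := pairSubstructure (ovsIncl K) A hM.realize_closureSentence
  obtain ⟨Q, hQ, -⟩ := exists_submodule_eq 𝒜
  have hQA : (Q : Set M) = A := hQ
  let _ := pairStructure (ovsLang K) A
  let Γ : Set (FormulaOver (pairLang (ovsLang K)) C) :=
    (fun φ => LHom.sumInl.onFormula φ) '' q ∪
      {γ | ∃ (n : ℕ) (k : Fin n → K) (t : (ovsLang K).Term C), γ = avoidFormula k t}
  have hfin : FinSat Γ := by
    intro Δ hΔ
    -- `W` collects all scalars and `D` all translations occurring in `Δ`. Keeping `1` in `W`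
    -- ensures that `productSpan W A` contains the dense set `A`.
    obtain ⟨χ, hχ, W, D, hW, h1, hD, h⟩ : ∃ χ ∈ q, ∃ (W : Submodule ℚ K) (D : Set M),
        FiniteDimensional ℚ W ∧ 1 ∈ W ∧ D.Finite ∧ ∀ b : M, SatOver χ b →
          (∀ d ∈ D, b - d ∉ productSpan W A) → ∀ γ ∈ Δ, SatOver γ b := by
      induction Δ using Finset.induction_on with
      | empty =>
        exact ⟨⊤, hq.top_mem, Submodule.span ℚ {1}, ∅,
          FiniteDimensional.span_of_finite ℚ (Set.finite_singleton _),
          Submodule.subset_span rfl, Set.finite_empty, by simp⟩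
      | insert γ Δ _ ih =>
        rw [Finset.coe_insert, Set.insert_subset_iff] at hΔ
        obtain ⟨χ, hχ, W, D, hW, h1, hD, h⟩ := ih hΔ.2
        rcases hΔ.1 with ⟨φ, hφ, rfl⟩ | ⟨n, k, t, rfl⟩
        · refine ⟨φ ⊓ χ, hq.inf_mem hφ hχ, W, D, hW, h1, hD, fun b hb hbD γ hγ => ?_⟩
          have hb := Formula.realize_inf.1 hb
          rcases Finset.mem_insert.1 hγ with rfl | hγ
          exacts [(satOver_onFormula φ b).2 hb.1, h b hb.2 hbD γ hγ]
        · have : FiniteDimensional ℚ (Submodule.span ℚ (Set.range k)) :=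
            FiniteDimensional.span_of_finite ℚ (Set.finite_range k)
          refine ⟨χ, hχ, W ⊔ Submodule.span ℚ (Set.range k),
            insert (t.realize Subtype.val) D, inferInstance, Submodule.mem_sup_left h1,
            hD.insert _, fun b hb hbD γ hγ => ?_⟩
          rcases Finset.mem_insert.1 hγ with rfl | hγ
          · refine (satOver_avoidFormula k t b).2 fun x hx hbx => hbD _ (.inl rfl) ?_
            rw [hbx, add_sub_cancel_right]
            exact Submodule.sum_mem _ fun i _ => smul_mem_productSpan
              (Submodule.mem_sup_right (Submodule.subset_span ⟨i, rfl⟩)) (hx i)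
          · exact h b hb (fun d hd hbd => hbD d (.inr hd)
              (productSpan_mono le_sup_left A hbd)) γ hγ
    obtain ⟨x, y, hxy, hI⟩ := exists_interval_of_mem hna hχ
    obtain ⟨r, hr⟩ := exists_notMem_productSpan (Q := Q) (fun hk => by
      obtain ⟨r, hr⟩ := hM.exists_ne_sum hk
      exact ⟨r, fun x hx => hr x fun i => hQA ▸ hx i⟩) W
    rw [hQA] at hr
    obtain ⟨b, hxb, hby, hb⟩ := exists_mem_interval_forall_sub_notMem
      (fun _ _ => hM.exists_mem_between) (fun a ha => by
        have := smul_mem_productSpan h1 ha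
        rwa [one_smul] at this) hr hD hxy
    exact ⟨b, h b (hI b hxb hby) hb⟩
  obtain ⟨b, hb⟩ := hsat C hC Γ hfin
  refine ⟨b, fun hacl => ?_, fun φ hφ => (satOver_onFormula φ b).1 (hb _ (.inl ⟨φ, hφ, rfl⟩))⟩
  -- An element of `acl (A ∪ C)` is a `K`-combination of elements of `A` plus the value of a term
  -- over `C`, which is what the formulas `avoidFormula k t` in `Γ` forbid.
  rw [acl_eq_span, SetLike.mem_coe, ← Set.union_insert, Submodule.span_union] at hacl
  obtain ⟨x, hx, d, hd, rfl⟩ := Submodule.mem_sup.1 hacl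
  obtain ⟨n, k, g, rfl⟩ := Submodule.mem_span_set'.1 hx
  have hd' : d ∈ Submodule.span K (insert (ovsOne K M) (Set.range (Subtype.val : C → M))) := by
    rwa [Subtype.range_coe]
  obtain ⟨t, rfl⟩ := (mem_span_iff_exists_term _ _).1 hd'
  exact (satOver_avoidFormula k t _).1 (hb _ (.inr ⟨n, k, t, rfl⟩)) (fun i => (g i : M))
    (fun i => (g i).2) rfl

end PairsOfStructures

end

theorem mainTheorem12 (K : Subfield ℝ) (hK : K ≠ ⊥) :
    PairsOfStructures.IsOMLTheory.{w} (PairsOfStructures.ovsIncl K)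
      (PairsOfStructures.ovsTheory ℚ) (PairsOfStructures.ovsTheory K)
      (PairsOfStructures.TdK K) PairsOfStructures.ltSymb := by
  open PairsOfStructures in
  exact
    { sublanguage := ovsIncl_injective K
      satisfiable_α := isSatisfiable_ovsTheory ℚ
      satisfiable_β := isSatisfiable_ovsTheory K
      satisfiable_T2 := isSatisfiable_T2 K
      geometric := isGeometric_ovsTheory
      extendsDLO_α := extendsDLO_ovsTheory
      extendsDLO_β := extendsDLO_ovsTheory
      oMinimal_α := oMinimal_ovsTheory
      oMinimal_β := oMinimal_ovsTheory
      isMLTheory :=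
        { extends_T2 := TdK_models_T2 K
          mordellLang := mordellLangCondition_TdK
          density := densityCondition_TdK
          codensity := codensityCondition_TdK } }
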